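/- Let $n=q+p$, $\lambda_0>0$, $K,L\in\mathbb C^{n\times n}$ with $K$ invertible, and $K_y,L_y\in\mathbb C^{m\times n}$. Consider on $X=L^2(0,1;\mathbb C^n)$ the port-Hamiltonian system with uniform constant wave speed $$\frac{\partial z}{\partial t}(\zeta,t)=-\lambda_0\frac{\partial z}{\partial\zeta}(\zeta,t),\quad z(\zeta,0)=z_0(\zeta),\quad \begin{bmatrix}0\\u(t)\end{bmatrix}=-\lambda_0Kz(0,t)-\lambda_0Lz(1,t),\quad y(t)=-\lambda_0K_yz(0,t)-\lambda_0L_yz(1,t),$$ with $0\in\mathbb C^q$, input $u\in L^2_{loc}(0,\infty;\mathbb C^p)$ and output $y\in L^2_{loc}(0,\infty;\mathbb C^m)$. Solutions are mild solutions: $z\in C([0,\infty);X)$, $z(0)=z_0$, and for every $t\ge0$ the function $w=\int_0^tz(s)\,ds$ lies in $H^1(0,1;\mathbb C^n)$ and satisfies $z(t)-z_0=-\lambda_0w'$, $\begin{bmatrix}0\\\int_0^tu\end{bmatrix}=-\lambda_0Kw(0)-\lambda_0Lw(1)$ and $\int_0^ty=-\lambda_0K_yw(0)-\lambda_0L_yw(1)$.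 The zero dynamics is the set of pairs $(z_0,u)$ for which some mild solution has $y=0$, and the largest output nulling subspace $V^*\subset X$ is the set of the $z_0$ occurring in such pairs. Let $V_d^*\subset\mathbb C^n$ be the set of initial states $w(0)$ for which some input sequence $(u(j))_{j\ge 0}$ makes the output of $w(j+1)=A_dw(j)+B_du(j)$, $y(j)=C_dw(j)+D_du(j)$ vanish identically, where $A_d=-K^{-1}L$, $B_d=-\lambda_0^{-1}K^{-1}\begin{bmatrix}0\\I\end{bmatrix}$, $C_d=-\lambda_0K_yA_d-\lambda_0L_y$, $D_d=-\lambda_0K_yB_d$. Then the following hold. 1. $V^*=L^2(0,1;V_d^*)$, and $V^*$ is closed in $X$. 2. The dynamics can be restricted to $V^*$, and the restriction is a well-posed port-Hamiltonian system without inputs. That is, there are $k\ge 0$, a linear isometry $J:\mathbb C^k\to\mathbb C^n$ with range $V_d^*$ (so that $w\mapsto Jw$ maps $L^2(0,1;\mathbb C^k)$ onto $V^*$), matrices $K_w,L_w\in\mathbb C^{k\times k}$ with $K_w$ invertible, and matrices $K_{w,u},L_{w,u}\in\mathbb C^{p\times k}$, such that the system $$\frac{\partial w}{\partial t}=-\lambda_0\frac{\partial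 w}{\partial\zeta},\qquad 0=-\lambda_0K_ww(0,t)-\lambda_0L_ww(1,t),\qquad u(t)=-\lambda_0K_{w,u}w(0,t)-\lambda_0L_{w,u}w(1,t)$$ with output $u$ is well-posed on $L^2(0,1;\mathbb C^k)$ (for each initial value $w_0$ the mild solution $w$ and the output $u\in L^2_{loc}$ exist, are unique, and depend continuously on $w_0$, uniformly on bounded time intervals), and for each $w_0$ the function $Jw$ is the mild solution of the original system with initial value $Jw_0\in V^*$ and input $u$, and its output is $y=0$. 3. The system obtained from the original one by setting $y=0$, with state space $V^*$, no input, and $u$ regarded as output, is well-posed (existence, uniqueness and continuous dependence on $z_0\in V^*$ of $z$ and $u$) if and only if the zeroing input is unique, i.e. $u=0$ is the only input that produces $y=0$ from $z_0=0$. In that case the system in 2. is the whole zero dynamics: a triple $(z_0,z,u)$ consists of an initial value, the mild solution and the input of the original system with output $y=0$ if and only if $z_0=Jw_0$ and $z=Jw$ for a mild solution $w$, with initial value $w_0$ and output $u$, of the system in 2. -/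

import Mathlib

open MeasureTheory Set
open scoped Matrix

noncomputable section

/-- Lebesgue measure on the spatial interval `(0,1)`. -/
abbrev unitMeasure : Measure ℝ := volume.restrict (Ioo (0 : ℝ) 1)

/-- `ℂ^d` with the Euclidean norm. -/
abbrev CVec (d : ℕ) : Type := EuclideanSpace ℂ (Fin d)

/-- The space `L²(0,1;ℂ^d)`. -/
abbrev L2Unit (d : ℕ) : Type := Lp (CVec d) 2 unitMeasure

/-- `u ∈ L²_loc(0,∞;ℂ^d)`, for a function `u` of time (its values at negative times play no role):
square integrable on every bounded time interval `(0,T)`. -/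
def IsL2Loc {d : ℕ} (u : ℝ → CVec d) : Prop :=
  ∀ T : ℝ, 0 < T → MemLp u 2 (volume.restrict (Ioo (0 : ℝ) T))

/-- `w ∈ H¹(0,1;ℂ^d)` with weak derivative `w' ∈ L²(0,1;ℂ^d)` and boundary values
`w(0) = a`, `w(1) = b`: the absolutely continuous representative of `w` is
`ζ ↦ a + ∫₀^ζ w'`, and its value at `1` is `b`. -/
def IsH1With {d : ℕ} (w w' : L2Unit d) (a b : CVec d) : Prop :=
  (∀ᵐ ζ ∂unitMeasure, w ζ = a + ∫ s in (0 : ℝ)..ζ, w' s) ∧ b = a + ∫ s in (0 : ℝ)..1, w' s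

/-- The data of a port-Hamiltonian system with uniform constant wave speed on `L²(0,1;ℂ^n)`,
`n = q + p`, with `p` inputs and `m` outputs:
`∂z/∂t = -lam ∂z/∂ζ`, `[0; u(t)] = -lam K z(0,t) - lam L z(1,t)`,
`y(t) = -lam Ky z(0,t) - lam Ly z(1,t)`.
The first `q` rows of `K`, `L` are the homogeneous boundary conditions, the last `p` rows
carry the input. -/
structure PHSystem (q p m : ℕ) where
  /-- the wave speed -/
  lam : ℝ
  K : Matrix (Fin (q + p)) (Fin (q + p)) ℂ
  L : Matrix (Fin (q + p)) (Fin (q + p)) ℂ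
  Ky : Matrix (Fin m) (Fin (q + p)) ℂ
  Ly : Matrix (Fin m) (Fin (q + p)) ℂ

namespace PHSystem

variable {q p m : ℕ}

/-- `z` is the mild solution on `[0,∞)` with initial value `z₀`, input `u ∈ L²_loc` and output
`y ∈ L²_loc`. That is, `z : [0,∞) → L²(0,1;ℂ^n)` is continuous, and all equations of the system
hold in integrated form: for each `t ≥ 0` the function `w = ∫₀ᵗ z(s) ds` lies in `H¹(0,1;ℂ^n)`,
`z(t) - z₀ = -lam ∂w/∂ζ`, `[0; ∫₀ᵗ u] = -lam K w(0) - lam L w(1)` and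
`∫₀ᵗ y = -lam Ky w(0) - lam Ly w(1)`. -/
def IsMildSolution (S : PHSystem q p m) (z₀ : L2Unit (q + p)) (u : ℝ → CVec p)
    (z : ℝ → L2Unit (q + p)) (y : ℝ → CVec m) : Prop :=
  IsL2Loc u ∧ IsL2Loc y ∧ ContinuousOn z (Ici 0) ∧ z 0 = z₀ ∧
  ∀ t : ℝ, 0 ≤ t → ∃ (w' : L2Unit (q + p)) (a b : CVec (q + p)),
    IsH1With (∫ s in (0 : ℝ)..t, z s) w' a b ∧
    z t - z₀ = (-(S.lam : ℂ)) • w' ∧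
    Fin.append (0 : Fin q → ℂ) (∫ s in (0 : ℝ)..t, u s).ofLp
      = (-(S.lam : ℂ)) • (S.K *ᵥ a.ofLp) - (S.lam : ℂ) • (S.L *ᵥ b.ofLp) ∧
    (∫ s in (0 : ℝ)..t, y s).ofLp
      = (-(S.lam : ℂ)) • (S.Ky *ᵥ a.ofLp) - (S.lam : ℂ) • (S.Ly *ᵥ b.ofLp)

/-- Well-posedness on `L²(0,1;ℂ^n)`: for all initial values and all `L²_loc` inputs there is
exactly one mild solution and exactly one output, and both depend continuously on the initial
value and the input, uniformly on bounded time intervals. -/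
def IsWellPosed (S : PHSystem q p m) : Prop :=
  (∀ (z₀ : L2Unit (q + p)) (u : ℝ → CVec p), IsL2Loc u →
    ∃ (z : ℝ → L2Unit (q + p)) (y : ℝ → CVec m), S.IsMildSolution z₀ u z y) ∧
  (∀ (z₀ : L2Unit (q + p)) (u : ℝ → CVec p) (z₁ z₂ : ℝ → L2Unit (q + p)) (y₁ y₂ : ℝ → CVec m),
    S.IsMildSolution z₀ u z₁ y₁ → S.IsMildSolution z₀ u z₂ y₂ →
      EqOn z₁ z₂ (Ici 0) ∧ y₁ =ᵐ[volume.restrict (Ioi (0 : ℝ))] y₂) ∧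
  (∀ T : ℝ, 0 < T → ∃ M : ℝ, ∀ (z₀ : L2Unit (q + p)) (u : ℝ → CVec p)
    (z : ℝ → L2Unit (q + p)) (y : ℝ → CVec m), S.IsMildSolution z₀ u z y →
      ∀ t ∈ Icc (0 : ℝ) T, ‖z t‖ ^ 2 + ∫ s in (0 : ℝ)..t, ‖y s‖ ^ 2
        ≤ M * (‖z₀‖ ^ 2 + ∫ s in (0 : ℝ)..t, ‖u s‖ ^ 2))

/-- The zero dynamics: the pairs `(z₀, u)` whose mild solution has output `y = 0`. -/
def zeroDynamics (S : PHSystem q p m) : Set (L2Unit (q + p) × (ℝ → CVec p)) :=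
  {x | ∃ z : ℝ → L2Unit (q + p), S.IsMildSolution x.1 x.2 z 0}

/-- The largest output nulling subspace `V*`. -/
def outputNulling (S : PHSystem q p m) : Set (L2Unit (q + p)) :=
  {z₀ | ∃ u : ℝ → CVec p, (z₀, u) ∈ S.zeroDynamics}

/-- The zeroing input is unique: from the initial value `0` only `u = 0` gives `y = 0`. -/
def ZeroingInputUnique (S : PHSystem q p m) : Prop :=
  ∀ u : ℝ → CVec p, (0, u) ∈ S.zeroDynamics → u =ᵐ[volume.restrict (Ioi (0 : ℝ))] 0

/-- The system with boundary conditions `0 = K₀ z(0,t) + L₀ z(1,t)`, `0 = Ky z(0,t) + Ly z(1,t)`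
(obtained by setting `y = 0`), on the state space `V*`, without input, and with `u` regarded as
its output, is well-posed: for every initial value in `V*` there is exactly one solution
`z` in `V*` and exactly one output `u`, depending continuously on the initial value. -/
def ZeroSystemWellPosed (S : PHSystem q p m) : Prop :=
  (∀ z₀ ∈ S.outputNulling, ∃ (u : ℝ → CVec p) (z : ℝ → L2Unit (q + p)),
    S.IsMildSolution z₀ u z 0 ∧ ∀ t : ℝ, 0 ≤ t → z t ∈ S.outputNulling) ∧
  (∀ (z₀ : L2Unit (q + p)) (u₁ u₂ : ℝ → CVec p) (z₁ z₂ : ℝ → L2Unit (q + p)),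
    S.IsMildSolution z₀ u₁ z₁ 0 → S.IsMildSolution z₀ u₂ z₂ 0 →
      EqOn z₁ z₂ (Ici 0) ∧ u₁ =ᵐ[volume.restrict (Ioi (0 : ℝ))] u₂) ∧
  (∀ T : ℝ, 0 < T → ∃ M : ℝ, ∀ (z₀ : L2Unit (q + p)) (u : ℝ → CVec p)
    (z : ℝ → L2Unit (q + p)), S.IsMildSolution z₀ u z 0 →
      ∀ t ∈ Icc (0 : ℝ) T, ‖z t‖ ^ 2 + ∫ s in (0 : ℝ)..t, ‖u s‖ ^ 2 ≤ M * ‖z₀‖ ^ 2)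

/-! The associated finite-dimensional discrete-time system. -/

/-- `A_d = -K⁻¹ L` -/
def Ad (S : PHSystem q p m) : Matrix (Fin (q + p)) (Fin (q + p)) ℂ := -(S.K⁻¹ * S.L)

/-- `B_d = -lam⁻¹ K⁻¹ [0; I]` -/
def Bd (S : PHSystem q p m) : Matrix (Fin (q + p)) (Fin p) ℂ :=
  (-(S.lam : ℂ)⁻¹) • (S.K⁻¹ *
    (Matrix.fromRows (0 : Matrix (Fin q) (Fin p) ℂ) (1 : Matrix (Fin p) (Fin p) ℂ)).submatrix
      finSumFinEquiv.symm id)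

/-- `C_d = -lam Ky A_d - lam Ly` -/
def Cd (S : PHSystem q p m) : Matrix (Fin m) (Fin (q + p)) ℂ :=
  (-(S.lam : ℂ)) • (S.Ky * S.Ad) - (S.lam : ℂ) • S.Ly

/-- `D_d = -lam Ky B_d` -/
def Dd (S : PHSystem q p m) : Matrix (Fin m) (Fin p) ℂ := (-(S.lam : ℂ)) • (S.Ky * S.Bd)

/-- The largest output nulling subspace `V_d*` of the discrete-time system
`w(k+1) = A_d w(k) + B_d u(k)`, `y(k) = C_d w(k) + D_d u(k)`: the initial states for which some
input sequence makes the output vanish identically. -/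
def discreteOutputNulling (S : PHSystem q p m) : Submodule ℂ (CVec (q + p)) where
  carrier := {v | ∃ (w : ℕ → Fin (q + p) → ℂ) (u : ℕ → Fin p → ℂ), w 0 = v.ofLp ∧
    ∀ k, w (k + 1) = S.Ad *ᵥ w k + S.Bd *ᵥ u k ∧ S.Cd *ᵥ w k + S.Dd *ᵥ u k = 0}
  zero_mem' := ⟨0, 0, by simp, by simp⟩
  add_mem' := by
    rintro v v' ⟨w, u, h0, h⟩ ⟨w', u', h0', h'⟩
    refine ⟨w + w', u + u', by simp [h0, h0'], fun k => ⟨?_, ?_⟩⟩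
    · simp only [Pi.add_apply, (h k).1, (h' k).1, Matrix.mulVec_add]
      abel
    · have := congrArg₂ (· + ·) (h k).2 (h' k).2
      simp only [add_zero] at this
      simp only [Pi.add_apply, Matrix.mulVec_add]
      rw [← this]
      abel
  smul_mem' := by
    rintro c v ⟨w, u, h0, h⟩
    refine ⟨c • w, c • u, by simp [h0], fun k => ⟨?_, ?_⟩⟩
    · simp only [Pi.smul_apply, (h k).1, Matrix.mulVec_smul, smul_add]
    · simp only [Pi.smul_apply, Matrix.mulVec_smul, ← smul_add, (h k).2, smul_zero]

end PHSystem

/-- `L²(0,1;V)` as a subset of `L²(0,1;ℂ^d)`, for a subspace `V` of `ℂ^d`. -/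
def L2Sub {d : ℕ} (V : Submodule ℂ (CVec d)) : Set (L2Unit d) :=
  {z | ∀ᵐ ζ ∂unitMeasure, z ζ ∈ V}

/-- The map `L²(0,1;ℂ^k) → L²(0,1;ℂ^d)`, `w ↦ J ∘ w`, for a linear isometry `J : ℂ^k → ℂ^d`. -/
def liftL2 {k d : ℕ} (J : CVec k →ₗᵢ[ℂ] CVec d) (w : L2Unit k) : L2Unit d :=
  J.toContinuousLinearMap.compLp w

end

/-! The equation is pure transport to the right at speed `λ₀`, so a mild solution is a travelling
profile, `z(t)(ζ) = ψ(ζ - λ₀ t)`. On `(0,1)` the profile is the initial value. As `K` is invertible,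
the boundary condition continues it to negative arguments by the delay equation `ψ(x) = A_d ψ(x+1) +
B_d u(-x/λ₀)`. Hence, for fixed `x ∈ (0,1)`, the samples `ψ(x - k)` form a trajectory of the
discrete-time system, and the output at time `(k+1-x)/λ₀` is the discrete output at step `k`.

Solving the delay equation in unit steps gives existence and the continuity estimate
(`exists_travelWave_solution`, `isWellPosed_of_isUnit_det`). For uniqueness, the time integral of a
mild solution is shown to be constant along characteristics (`ae_eq_leftTrace`,
`rightTrace_eq_leftTrace`), so its boundary value obeys a homogeneous delay equation and vanishes
(`IsMildSolution.eq_zero`).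

If `y = 0`, then for almost every `x` the samples are an output nulling discrete trajectory, which
gives `V* ⊆ L²(0,1;V_d*)` (`outputNulling_subset`). For the converse, `V_d*` is controlled
invariant, and a zeroing input chosen on a basis extends to a linear feedback `F` with closed loop
`G` in orthonormal coordinates (`exists_feedback`). The port-Hamiltonian system `w(0,t) = G w(1,t)`,
`u(t) = F w(1,t)` is well-posed, and its solutions lift isometrically to solutions with zero output
(`IsMildSolution.lift`). Linearity of the feedback makes any measurable selection of inputs
superfluous.

Two solutions with zero output and the same initial value differ by one that starts at `0`. If the
zeroing input is unique, the lifted solutions are therefore all solutions with zero output, and they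
inherit the estimates of the restricted system. -/

noncomputable section

/-! ### Matrices as operators on Euclidean spaces -/

/-- The operator between Euclidean spaces given by a matrix. -/
def mulVecCLM {a b : ℕ} (P : Matrix (Fin a) (Fin b) ℂ) : CVec b →L[ℂ] CVec a :=
  (Matrix.toLpLin 2 2 P).toContinuousLinearMap

@[simp] lemma ofLp_mulVecCLM {a b : ℕ} (P : Matrix (Fin a) (Fin b) ℂ) (x : CVec b) :
    (mulVecCLM P x).ofLp = P *ᵥ x.ofLp := by
  simp [mulVecCLM]

/-- The embedding `v ↦ [0; v]`. -/
def embLast (q p : ℕ) : CVec p →L[ℂ] CVec (q + p) :=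
  mulVecCLM ((Matrix.fromRows (0 : Matrix (Fin q) (Fin p) ℂ)
    (1 : Matrix (Fin p) (Fin p) ℂ)).submatrix finSumFinEquiv.symm id)

lemma ofLp_embLast {q p : ℕ} (v : CVec p) :
    (embLast q p v).ofLp = Fin.append (0 : Fin q → ℂ) v.ofLp := by
  rw [embLast, ofLp_mulVecCLM]
  funext i
  refine Fin.addCases (fun i => ?_) (fun i => ?_) i
  · simp [Matrix.mulVec, dotProduct]
  · simp [Matrix.mulVec, dotProduct, Matrix.one_apply]

/-! ### Locally square integrable functions of time -/

namespace IsL2Loc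

variable {d : ℕ} {u v : ℝ → CVec d}

lemma zero : IsL2Loc (0 : ℝ → CVec d) := fun _ _ => MemLp.zero

lemma sub (hu : IsL2Loc u) (hv : IsL2Loc v) : IsL2Loc (u - v) := fun T hT =>
  (hu T hT).sub (hv T hT)

lemma ae_restrict_of_ae {P : ℝ → Prop} (h : ∀ᵐ t ∂(volume.restrict (Ioi (0 : ℝ))), P t) (T : ℝ) :
    ∀ᵐ t ∂(volume.restrict (Ioo (0 : ℝ) T)), P t :=
  ae_restrict_of_ae_restrict_of_subset Ioo_subset_Ioi_self h

lemma congr (hu : IsL2Loc u) (h : u =ᵐ[volume.restrict (Ioi (0 : ℝ))] v) : IsL2Loc v :=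
  fun T hT => (memLp_congr_ae (ae_restrict_of_ae h T)).1 (hu T hT)

lemma memLp (hu : IsL2Loc u) (T : ℝ) : MemLp u 2 (volume.restrict (Ioc (0 : ℝ) T)) := by
  rcases le_or_gt T 0 with h | h
  · simp [Ioc_eq_empty (not_lt.2 h)]
  · rw [← restrict_Ioo_eq_restrict_Ioc]; exact hu T h

lemma intervalIntegrable (hu : IsL2Loc u) {T : ℝ} (hT : 0 ≤ T) :
    IntervalIntegrable u volume 0 T := by
  rw [intervalIntegrable_iff_integrableOn_Ioc_of_le hT]
  exact (hu.memLp T).integrable (by norm_num)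

lemma intervalIntegrable_sq (hu : IsL2Loc u) {T : ℝ} (hT : 0 ≤ T) :
    IntervalIntegrable (fun t => ‖u t‖ ^ 2) volume 0 T := by
  rw [intervalIntegrable_iff_integrableOn_Ioc_of_le hT]
  exact (hu.memLp T).integrable_norm_pow (by norm_num)

end IsL2Loc

lemma intervalIntegral_congr_of_ae_Ioi {E : Type*} [NormedAddCommGroup E] [NormedSpace ℝ E]
    {u v : ℝ → E} (h : u =ᵐ[volume.restrict (Ioi (0 : ℝ))] v)
    {t : ℝ} (ht : 0 ≤ t) : ∫ s in (0 : ℝ)..t, u s = ∫ s in (0 : ℝ)..t, v s := by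
  rw [intervalIntegral.integral_of_le ht, intervalIntegral.integral_of_le ht]
  exact integral_congr_ae (ae_restrict_of_ae_restrict_of_subset Ioc_subset_Ioi_self h)

/-- A function whose primitive vanishes is zero. -/
lemma ae_eq_zero_of_primitive_eq_zero {E : Type*} [NormedAddCommGroup E] [NormedSpace ℝ E]
    [CompleteSpace E] {f : ℝ → E} {T : ℝ} (hf : IntervalIntegrable f volume 0 T)
    (h : ∀ t ∈ Icc 0 T, ∫ s in (0 : ℝ)..t, f s = 0) :
    ∀ᵐ t ∂(volume.restrict (Ioo (0 : ℝ) T)), f t = 0 := by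
  rcases lt_or_ge T 0 with hT | hT
  · simp [Ioo_eq_empty (not_lt.2 hT.le)]
  rw [ae_restrict_iff' measurableSet_Ioo]
  filter_upwards [hf.ae_hasDerivAt_integral] with t ht hmem
  have h1 := ht (by rw [uIcc_of_le hT]; exact Ioo_subset_Icc_self hmem) 0 (by simp)
  have h2 : HasDerivAt (fun x => ∫ s in (0 : ℝ)..x, f s) 0 t := by
    refine (hasDerivAt_const t (0 : E)).congr_of_eventuallyEq ?_
    filter_upwards [Ioo_mem_nhds hmem.1 hmem.2] with x hx
    exact h x (Ioo_subset_Icc_self hx)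
  exact h1.unique h2

lemma IsL2Loc.ae_eq_zero {d : ℕ} {u : ℝ → CVec d} (hu : IsL2Loc u)
    (h : ∀ t, 0 ≤ t → ∫ s in (0 : ℝ)..t, u s = 0) : u =ᵐ[volume.restrict (Ioi (0 : ℝ))] 0 := by
  have hU : Ioi (0 : ℝ) = ⋃ n : ℕ, Ioo (0 : ℝ) n := by
    ext x
    simp only [mem_Ioi, mem_iUnion, mem_Ioo]
    exact ⟨fun hx => (exists_nat_gt x).imp fun n hn => ⟨hx, hn⟩, fun ⟨_, hx⟩ => hx.1⟩
  rw [hU]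
  refine (ae_restrict_iUnion_iff _ _).2 fun n => ?_
  exact ae_eq_zero_of_primitive_eq_zero (hu.intervalIntegrable (Nat.cast_nonneg n))
    fun t ht => h t ht.1

/-! ### Primitives of square integrable functions on the unit interval -/

lemma unitMeasure_univ : unitMeasure univ = 1 := by simp [unitMeasure]

instance isProbabilityMeasure_unitMeasure : IsProbabilityMeasure unitMeasure :=
  ⟨unitMeasure_univ⟩

lemma L2Unit.integrable {d : ℕ} (f : L2Unit d) : Integrable f unitMeasure :=
  (Lp.memLp f).integrable (by norm_num)

lemma L2Unit.integral_norm_le {d : ℕ} (f : L2Unit d) : ∫ s, ‖f s‖ ∂unitMeasure ≤ ‖f‖ := by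
  rw [integral_norm_eq_lintegral_enorm (Lp.aestronglyMeasurable f), Lp.norm_def,
    ← eLpNorm_one_eq_lintegral_enorm]
  refine ENNReal.toReal_mono (Lp.eLpNorm_ne_top f) ?_
  exact eLpNorm_le_eLpNorm_of_exponent_le (by norm_num) (Lp.aestronglyMeasurable f)

lemma L2Unit.intervalIntegrable {d : ℕ} (f : L2Unit d) :
    IntervalIntegrable f volume 0 1 := by
  rw [intervalIntegrable_iff_integrableOn_Ioo_of_le zero_le_one]
  exact f.integrable

lemma L2Unit.integrable_indicator {d : ℕ} (f : L2Unit d) :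
    Integrable ((Ioo (0 : ℝ) 1).indicator f) volume :=
  (integrable_indicator_iff measurableSet_Ioo).2 f.integrable

lemma L2Unit.indicator_congr {d : ℕ} {f : L2Unit d} {g : ℝ → CVec d} (h : f =ᵐ[unitMeasure] g) :
    (Ioo (0 : ℝ) 1).indicator f =ᵐ[volume] (Ioo (0 : ℝ) 1).indicator g := by
  filter_upwards [ae_imp_of_ae_restrict h] with s hs
  by_cases hmem : s ∈ Ioo (0 : ℝ) 1
  · simp [hmem, hs hmem]
  · simp [hmem]

/-- The value at `ζ` of the primitive of a function in `L²(0,1;ℂ^d)`, extended by zero to `ℝ`,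
as an operator. -/
def primitiveCLM {d : ℕ} (ζ : ℝ) : L2Unit d →L[ℂ] CVec d :=
  LinearMap.mkContinuous
    { toFun := fun f => ∫ s in (0 : ℝ)..ζ, (Ioo (0 : ℝ) 1).indicator f s
      map_add' := fun f g => by
        rw [← intervalIntegral.integral_add f.integrable_indicator.intervalIntegrable
          g.integrable_indicator.intervalIntegrable]
        refine intervalIntegral.integral_congr_ae ?_
        filter_upwards [L2Unit.indicator_congr (Lp.coeFn_add f g)] with s hs _
        rw [hs, Set.indicator_add']; rfl
      map_smul' := fun c f => by
        rw [RingHom.id_apply, ← intervalIntegral.integral_smul]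
        refine intervalIntegral.integral_congr_ae ?_
        filter_upwards [L2Unit.indicator_congr (Lp.coeFn_smul c f)] with s hs _
        rw [hs]; exact Set.indicator_const_smul_apply _ c f s }
    1 fun f => by
      rw [one_mul]
      refine le_trans ?_ f.integral_norm_le
      rw [← integral_indicator measurableSet_Ioo]
      simp only [LinearMap.coe_mk, AddHom.coe_mk]
      refine intervalIntegral.norm_integral_le_integral_norm_uIoc.trans ?_
      simp_rw [norm_indicator_eq_indicator_norm]
      exact setIntegral_le_integral
        (by simpa only [norm_indicator_eq_indicator_norm] using f.integrable_indicator.norm)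
        (Filter.Eventually.of_forall fun s => Set.indicator_nonneg (fun _ _ => norm_nonneg _) s)

section primitive

variable {d : ℕ}

lemma primitiveCLM_apply (ζ : ℝ) (f : L2Unit d) :
    primitiveCLM ζ f = ∫ s in (0 : ℝ)..ζ, (Ioo (0 : ℝ) 1).indicator f s := rfl

lemma norm_primitiveCLM_le (ζ : ℝ) (f : L2Unit d) : ‖primitiveCLM ζ f‖ ≤ ‖f‖ := by
  have h : ‖primitiveCLM (d := d) ζ‖ ≤ 1 := LinearMap.mkContinuous_norm_le _ zero_le_one _
  simpa using (primitiveCLM ζ).le_of_opNorm_le h f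

lemma intervalIntegral_indicator_Ioo {E : Type*} [NormedAddCommGroup E] [NormedSpace ℝ E]
    {ζ : ℝ} (hζ : ζ ∈ Icc (0 : ℝ) 1) (f : ℝ → E) :
    ∫ s in (0 : ℝ)..ζ, (Ioo (0 : ℝ) 1).indicator f s = ∫ s in (0 : ℝ)..ζ, f s := by
  rw [intervalIntegral.integral_of_le hζ.1, intervalIntegral.integral_of_le hζ.1,
    integral_Ioc_eq_integral_Ioo, integral_Ioc_eq_integral_Ioo]
  refine setIntegral_congr_fun measurableSet_Ioo fun s hs => ?_
  exact indicator_of_mem (show s ∈ Ioo (0 : ℝ) 1 from ⟨hs.1, hs.2.trans_le hζ.2⟩) f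

lemma primitiveCLM_eq {ζ : ℝ} (hζ : ζ ∈ Icc (0 : ℝ) 1) (f : L2Unit d) :
    primitiveCLM ζ f = ∫ s in (0 : ℝ)..ζ, f s :=
  intervalIntegral_indicator_Ioo hζ f

lemma primitiveCLM_eq_of_ae {ζ : ℝ} (hζ : ζ ∈ Icc (0 : ℝ) 1) {f : L2Unit d} {g : ℝ → CVec d}
    (h : f =ᵐ[unitMeasure] g) : primitiveCLM ζ f = ∫ s in (0 : ℝ)..ζ, g s := by
  rw [← intervalIntegral_indicator_Ioo hζ g, primitiveCLM_apply]
  refine intervalIntegral.integral_congr_ae ?_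
  filter_upwards [L2Unit.indicator_congr h] with s hs _ using hs

@[simp] lemma primitiveCLM_zero (f : L2Unit d) : primitiveCLM 0 f = 0 := by
  simp [primitiveCLM_apply]

lemma continuous_primitiveCLM (f : L2Unit d) : Continuous fun ζ => primitiveCLM ζ f := by
  simp only [primitiveCLM_apply]
  exact intervalIntegral.continuous_primitive
    (fun _ _ => f.integrable_indicator.intervalIntegrable) 0

/-- Continuity in `ζ` for fixed `f` suffices, since the dependence on `f` is 1-Lipschitz uniformly
in `ζ`. -/
lemma continuous_primitiveCLM_uncurry :
    Continuous fun x : ℝ × L2Unit d => primitiveCLM x.1 x.2 := by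
  refine continuous_prod_of_continuous_lipschitzWith' _ 1 (fun ζ => ?_) continuous_primitiveCLM
  refine LipschitzWith.of_dist_le_mul fun f g => ?_
  rw [dist_eq_norm, dist_eq_norm, ← map_sub]
  simpa using norm_primitiveCLM_le ζ (f - g)

/-- Elements of `L²` have no point values, so identities between them are proved below on primitives
and transferred back by this lemma. -/
lemma ae_eq_of_primitiveCLM_eq {f : L2Unit d} {g : ℝ → CVec d}
    (hg : IntervalIntegrable g volume 0 1)
    (h : ∀ ζ ∈ Icc (0 : ℝ) 1, primitiveCLM ζ f = ∫ s in (0 : ℝ)..ζ, g s) :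
    f =ᵐ[unitMeasure] g := by
  have := ae_eq_zero_of_primitive_eq_zero (f := fun s => f s - g s) (T := 1)
    (f.intervalIntegrable.sub hg) fun t ht => by
      have hsub : uIcc 0 t ⊆ uIcc (0 : ℝ) 1 := by
        rw [uIcc_of_le ht.1, uIcc_of_le zero_le_one]; exact Icc_subset_Icc_right ht.2
      rw [intervalIntegral.integral_sub (f.intervalIntegrable.mono_set hsub) (hg.mono_set hsub),
        ← primitiveCLM_eq ht, h t ht, sub_self]
  filter_upwards [this] with s hs using sub_eq_zero.1 hs

end primitive

/-! ### Functions in `H¹` -/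

namespace IsH1With

variable {d : ℕ} {w w' v v' : L2Unit d} {a b a₂ b₂ : CVec d}

lemma iff_primitive : IsH1With w w' a b ↔
    (∀ᵐ ζ ∂unitMeasure, w ζ = a + primitiveCLM ζ w') ∧ b = a + primitiveCLM 1 w' := by
  rw [IsH1With, primitiveCLM_eq (by simp)]
  refine and_congr_left fun _ => Filter.eventually_congr ?_
  filter_upwards [ae_restrict_mem measurableSet_Ioo] with ζ hζ
  rw [primitiveCLM_eq (Ioo_subset_Icc_self hζ)]

lemma zero : IsH1With (0 : L2Unit d) 0 0 0 := by
  rw [iff_primitive]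
  simp only [map_zero, add_zero, and_true]
  exact Lp.coeFn_zero _ _ _

lemma sub (hw : IsH1With w w' a b) (hv : IsH1With v v' a₂ b₂) :
    IsH1With (w - v) (w' - v') (a - a₂) (b - b₂) := by
  rw [iff_primitive] at *
  refine ⟨?_, by rw [hw.2, hv.2, map_sub]; abel⟩
  filter_upwards [hw.1, hv.1, Lp.coeFn_sub w v] with ζ h1 h2 h3
  rw [h3, Pi.sub_apply, h1, h2, map_sub]; abel

/-- The constant `a` is the mean over `(0,1)` of `w` minus the primitive of `w'`. This bound on the
trace makes boundary values continuous in time. -/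
lemma norm_left_le (hw : IsH1With w w' a b) : ‖a‖ ≤ ‖w‖ + ‖w'‖ := by
  rw [iff_primitive] at hw
  calc ‖a‖ = ∫ _ζ, ‖a‖ ∂unitMeasure := by simp
    _ ≤ ∫ ζ, (‖w ζ‖ + ‖w'‖) ∂unitMeasure := by
      refine integral_mono_ae (integrable_const _) (w.integrable.norm.add (integrable_const _)) ?_
      filter_upwards [hw.1] with ζ hζ
      have : a = w ζ - primitiveCLM ζ w' := by rw [hζ]; abel
      calc ‖a‖ ≤ ‖w ζ‖ + ‖primitiveCLM ζ w'‖ := by rw [this]; exact norm_sub_le _ _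
        _ ≤ _ := by gcongr; exact norm_primitiveCLM_le _ _
    _ = ∫ ζ, ‖w ζ‖ ∂unitMeasure + ‖w'‖ := by
      rw [integral_add w.integrable.norm (integrable_const _)]; simp
    _ ≤ _ := by gcongr; exact w.integral_norm_le

end IsH1With

/-! ### Mild solutions -/

namespace PHSystem

variable {q p m : ℕ} {S : PHSystem q p m}

/-- With vectors in place of coordinate functions, all boundary maps are continuous linear maps and
commute with differences and integrals. -/
lemma isMildSolution_iff {z₀ : L2Unit (q + p)} {u : ℝ → CVec p}
    {z : ℝ → L2Unit (q + p)} {y : ℝ → CVec m} : S.IsMildSolution z₀ u z y ↔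
    IsL2Loc u ∧ IsL2Loc y ∧ ContinuousOn z (Ici 0) ∧ z 0 = z₀ ∧
    ∀ t : ℝ, 0 ≤ t → ∃ (w' : L2Unit (q + p)) (a b : CVec (q + p)),
      IsH1With (∫ s in (0 : ℝ)..t, z s) w' a b ∧
      z t - z₀ = (-(S.lam : ℂ)) • w' ∧
      embLast q p (∫ s in (0 : ℝ)..t, u s)
        = (-(S.lam : ℂ)) • mulVecCLM S.K a - (S.lam : ℂ) • mulVecCLM S.L b ∧
      (∫ s in (0 : ℝ)..t, y s)
        = (-(S.lam : ℂ)) • mulVecCLM S.Ky a - (S.lam : ℂ) • mulVecCLM S.Ly b := by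
  unfold IsMildSolution
  simp only [← ofLp_embLast, ← ofLp_mulVecCLM, ← WithLp.ofLp_smul, ← WithLp.ofLp_sub]
  simp only [← WithLp.ext_iff]

lemma IsMildSolution.congr {z₀ : L2Unit (q + p)} {u u' : ℝ → CVec p}
    {z z' : ℝ → L2Unit (q + p)} {y y' : ℝ → CVec m} (h : S.IsMildSolution z₀ u z y)
    (hu : u =ᵐ[volume.restrict (Ioi (0 : ℝ))] u') (hz : EqOn z z' (Ici 0))
    (hy : y =ᵐ[volume.restrict (Ioi (0 : ℝ))] y') : S.IsMildSolution z₀ u' z' y' := by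
  obtain ⟨h1, h2, h3, h4, h5⟩ := h
  refine ⟨h1.congr hu, h2.congr hy, h3.congr hz.symm, (hz self_mem_Ici).symm.trans h4,
    fun t ht => ?_⟩
  have : ∫ s in (0 : ℝ)..t, z' s = ∫ s in (0 : ℝ)..t, z s :=
    intervalIntegral.integral_congr fun s hs => (hz (by
      rw [uIcc_of_le ht] at hs; exact hs.1)).symm
  rw [← intervalIntegral_congr_of_ae_Ioi hu ht, ← intervalIntegral_congr_of_ae_Ioi hy ht, this,
    ← hz (mem_Ici.2 ht)]
  exact h5 t ht

lemma intervalIntegrable_of_continuousOn_Ici {E : Type*} [NormedAddCommGroup E] {z : ℝ → E}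
    (h : ContinuousOn z (Ici 0)) {t : ℝ} (ht : 0 ≤ t) : IntervalIntegrable z volume 0 t :=
  ContinuousOn.intervalIntegrable (h.mono (by rw [uIcc_of_le ht]; exact Icc_subset_Ici_self))

lemma IsMildSolution.sub {z₁ z₂ : L2Unit (q + p)} {u u' : ℝ → CVec p}
    {z z' : ℝ → L2Unit (q + p)} {y y' : ℝ → CVec m} (h : S.IsMildSolution z₁ u z y)
    (h' : S.IsMildSolution z₂ u' z' y') :
    S.IsMildSolution (z₁ - z₂) (u - u') (z - z') (y - y') := by
  rw [isMildSolution_iff] at *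
  obtain ⟨h1, h2, h3, h4, h5⟩ := h
  obtain ⟨k1, k2, k3, k4, k5⟩ := h'
  refine ⟨h1.sub k1, h2.sub k2, h3.sub k3, by simp [h4, k4], fun t ht => ?_⟩
  obtain ⟨w, a, b, e1, e2, e3, e4⟩ := h5 t ht
  obtain ⟨w', a', b', e1', e2', e3', e4'⟩ := k5 t ht
  refine ⟨w - w', a - a', b - b', ?_, ?_, ?_, ?_⟩
  · simp only [Pi.sub_apply]
    rw [intervalIntegral.integral_sub (intervalIntegrable_of_continuousOn_Ici h3 ht)
      (intervalIntegrable_of_continuousOn_Ici k3 ht)]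
    exact e1.sub e1'
  · rw [smul_sub, ← e2, ← e2', Pi.sub_apply]; abel
  · simp only [Pi.sub_apply]
    rw [intervalIntegral.integral_sub (h1.intervalIntegrable ht) (k1.intervalIntegrable ht),
      map_sub, e3, e3']
    simp only [map_sub, smul_sub]; abel
  · simp only [Pi.sub_apply]
    rw [intervalIntegral.integral_sub (h2.intervalIntegrable ht) (k2.intervalIntegrable ht), e4,
      e4']
    simp only [map_sub, smul_sub]; abel

end PHSystem

/-! ### Transport along characteristics and uniqueness of mild solutions -/

section transport

variable {d : ℕ} {c : ℝ} {Z : ℝ → L2Unit d} {a b : ℝ → CVec d}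

lemma continuous_leftTrace (hZ : Continuous Z)
    (h : ∀ t, IsH1With (∫ s in (0 : ℝ)..t, Z s) ((-(c : ℂ)⁻¹) • Z t) (a t) (b t)) :
    Continuous a := by
  have hW : Continuous fun t => ∫ s in (0 : ℝ)..t, Z s :=
    intervalIntegral.continuous_primitive (fun _ _ => hZ.intervalIntegrable _ _) 0
  rw [continuous_iff_continuousAt]
  intro s
  rw [ContinuousAt, tendsto_iff_norm_sub_tendsto_zero]
  refine squeeze_zero (fun _ => norm_nonneg _) (fun t => ((h t).sub (h s)).norm_left_le) ?_
  have : Continuous fun t => ‖(∫ r in (0 : ℝ)..t, Z r) - ∫ r in (0 : ℝ)..s, Z r‖ +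
      ‖(-(c : ℂ)⁻¹) • Z t - (-(c : ℂ)⁻¹) • Z s‖ := by fun_prop
  simpa using this.tendsto s

lemma hasDerivAt_primitiveCLM_of_isH1With {w w' : L2Unit d} {a b : CVec d}
    (h : IsH1With w w' a b) {ζ : ℝ} (hζ : ζ ∈ Ioo (0 : ℝ) 1) :
    HasDerivAt (fun x => primitiveCLM x w) (a + primitiveCLM ζ w') ζ := by
  have hc : Continuous fun x => a + primitiveCLM x w' :=
    continuous_const.add (continuous_primitiveCLM w')
  refine (hc.integral_hasStrictDerivAt 0 ζ).hasDerivAt.congr_of_eventuallyEq ?_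
  filter_upwards [Ioo_mem_nhds hζ.1 hζ.2] with x hx
  exact primitiveCLM_eq_of_ae (Ioo_subset_Icc_self hx) (IsH1With.iff_primitive.1 h).1

/-- With `W(r) = ∫₀ʳ Z`, the primitive of `W(r)` up to `ζ` has `ζ`-derivative `a(r) - c⁻¹ P` and
`r`-derivative `P`, where `P` is the primitive of `Z(r)` up to `ζ`. Along a line of slope `c` the
terms in `P` cancel. The extra integration in `ζ` makes both partial derivatives jointly continuous,
as the chain rule needs. -/
lemma hasDerivAt_primitiveCLM_characteristic (hc : 0 < c) (hZ : Continuous Z)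
    (h : ∀ t, IsH1With (∫ s in (0 : ℝ)..t, Z s) ((-(c : ℂ)⁻¹) • Z t) (a t) (b t))
    (e : ℝ) {s : ℝ} (hs : e + c * s ∈ Ioo (0 : ℝ) 1) :
    HasDerivAt (fun r => primitiveCLM (e + c * r) (∫ x in (0 : ℝ)..r, Z x)) (c • a s) s := by
  have ha := continuous_leftTrace hZ h
  let f₁ : ℝ → ℝ → ℝ →L[ℝ] CVec d := fun ζ s =>
    ContinuousLinearMap.toSpanSingleton ℝ (a s + primitiveCLM ζ ((-(c : ℂ)⁻¹) • Z s))
  let f₂ : ℝ → ℝ → ℝ →L[ℝ] CVec d := fun ζ s =>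
    ContinuousLinearMap.toSpanSingleton ℝ (primitiveCLM ζ (Z s))
  have hspan : Continuous fun v : CVec d => ContinuousLinearMap.toSpanSingleton ℝ v :=
    (ContinuousLinearMap.toSpanSingletonCLE (𝕜 := ℝ) (E := CVec d)).continuous
  have hF := hasStrictFDerivAt_uncurry_coprod (𝕜 := ℝ) (u := (e + c * s, s))
    (f := fun ζ s => primitiveCLM ζ (∫ x in (0 : ℝ)..s, Z x)) (f₁ := f₁) (f₂ := f₂) ?_ ?_ ?_ ?_
  · have hcurve : HasDerivAt (fun r : ℝ => (e + c * r, r)) (c, 1) s := by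
      refine HasDerivAt.prodMk ?_ (hasDerivAt_id s)
      simpa using ((hasDerivAt_id s).const_mul c).const_add e
    have := HasFDerivAt.comp_hasDerivAt_of_eq s hF.hasFDerivAt hcurve rfl
    refine this.congr_deriv ?_
    simp only [Function.HasUncurry.uncurry, id, ContinuousLinearMap.coprod_apply, f₁, f₂,
      ContinuousLinearMap.toSpanSingleton_apply, map_smul, smul_add, one_smul]
    have : c • (-(c : ℂ)⁻¹) • primitiveCLM (e + c * s) (Z s) = - primitiveCLM (e + c * s) (Z s) := by
      rw [← Complex.coe_smul, smul_smul, mul_neg, mul_inv_cancel₀ (by exact_mod_cast hc.ne'),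
        neg_one_smul]
    rw [this, neg_add_cancel_right]
  · filter_upwards [(isOpen_Ioo.preimage continuous_fst).mem_nhds hs] with v hv
    exact (hasDerivAt_primitiveCLM_of_isH1With (h v.2) hv).hasFDerivAt
  · refine Filter.Eventually.of_forall fun v => ?_
    have h1 := (hZ.integral_hasStrictDerivAt 0 v.2).hasDerivAt
    have h2 := ((primitiveCLM (d := d) v.1).restrictScalars ℝ).hasFDerivAt.comp_hasDerivAt v.2 h1
    exact h2.hasFDerivAt
  · have h1 : Continuous fun x : ℝ × ℝ => (x.1, (-(c : ℂ)⁻¹) • Z x.2) := by fun_prop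
    have h2 : Continuous fun x : ℝ × ℝ => a x.2 + primitiveCLM x.1 ((-(c : ℂ)⁻¹) • Z x.2) :=
      (ha.comp continuous_snd).add (continuous_primitiveCLM_uncurry.comp h1)
    exact (hspan.comp h2).continuousAt
  · have h1 : Continuous fun x : ℝ × ℝ => (x.1, Z x.2) := by fun_prop
    have h2 : Continuous fun x : ℝ × ℝ => primitiveCLM x.1 (Z x.2) :=
      continuous_primitiveCLM_uncurry.comp h1
    exact (hspan.comp h2).continuousAt

lemma primitiveCLM_eq_integral_leftTrace (hc : 0 < c) (hZ : Continuous Z)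
    (h : ∀ t, IsH1With (∫ s in (0 : ℝ)..t, Z s) ((-(c : ℂ)⁻¹) • Z t) (a t) (b t))
    (t : ℝ) {ζ : ℝ} (hζ : ζ ∈ Icc (0 : ℝ) 1) :
    primitiveCLM ζ (∫ s in (0 : ℝ)..t, Z s) = ∫ σ in (0 : ℝ)..ζ, a (t - c⁻¹ * σ) := by
  have ha := continuous_leftTrace hZ h
  have hW : Continuous fun t => ∫ s in (0 : ℝ)..t, Z s :=
    intervalIntegral.continuous_primitive (fun _ _ => hZ.intervalIntegrable _ _) 0
  have hle : t - c⁻¹ * ζ ≤ t := by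
    have := mul_nonneg (inv_pos.2 hc).le hζ.1; linarith
  -- The characteristic through `(ζ, t)` is followed back to the time `t - ζ/c`, at which it meets
  -- the boundary `ζ = 0` and the primitive vanishes.
  have key := intervalIntegral.integral_eq_sub_of_hasDerivAt_of_le hle
    (f := fun r => primitiveCLM ((ζ - c * t) + c * r) (∫ x in (0 : ℝ)..r, Z x))
    (f' := fun s => c • a s)
    (continuous_primitiveCLM_uncurry.comp
      (Continuous.prodMk (by fun_prop) hW)).continuousOn
    (fun s hs => hasDerivAt_primitiveCLM_characteristic hc hZ h _ (by
      have h1 : c * (t - c⁻¹ * ζ) < c * s := by gcongr; exact hs.1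
      have h2 : c * s < c * t := by gcongr; exact hs.2
      rw [mul_sub, mul_inv_cancel_left₀ hc.ne'] at h1
      exact ⟨by linarith, by linarith [hζ.2]⟩))
    ((ha.const_smul c).intervalIntegrable _ _)
  have h0 : ζ - c * t + c * (t - c⁻¹ * ζ) = 0 := by field_simp; ring
  have h1 : ζ - c * t + c * t = ζ := by ring
  simp only [h0, h1, primitiveCLM_zero, sub_zero] at key
  rw [← key, intervalIntegral.integral_smul, intervalIntegral.integral_comp_sub_mul a
    (inv_ne_zero hc.ne')]
  simp

lemma ae_eq_leftTrace (hc : 0 < c) (hZ : Continuous Z)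
    (h : ∀ t, IsH1With (∫ s in (0 : ℝ)..t, Z s) ((-(c : ℂ)⁻¹) • Z t) (a t) (b t)) (t : ℝ) :
    (∫ s in (0 : ℝ)..t, Z s : L2Unit d) =ᵐ[unitMeasure] fun ζ => a (t - c⁻¹ * ζ) := by
  have ha := continuous_leftTrace hZ h
  exact ae_eq_of_primitiveCLM_eq (Continuous.intervalIntegrable (by fun_prop) _ _)
    fun ζ hζ => primitiveCLM_eq_integral_leftTrace hc hZ h t hζ

/-- Both sides of the characteristic identity are continuous in `ζ` on `[0,1]`, so the almost
everywhere equality holds at `ζ = 1` too: what leaves at the right end entered at the left end `c⁻¹`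
earlier. -/
lemma rightTrace_eq_leftTrace (hc : 0 < c) (hZ : Continuous Z)
    (h : ∀ t, IsH1With (∫ s in (0 : ℝ)..t, Z s) ((-(c : ℂ)⁻¹) • Z t) (a t) (b t)) (t : ℝ) :
    b t = a (t - c⁻¹) := by
  have ha := continuous_leftTrace hZ h
  obtain ⟨h1, h2⟩ := IsH1With.iff_primitive.1 (h t)
  have h3 : (fun ζ => a t + primitiveCLM ζ ((-(c : ℂ)⁻¹) • Z t)) =ᵐ[volume.restrict (Icc 0 1)]
      fun ζ => a (t - c⁻¹ * ζ) := by
    rw [← restrict_Ioo_eq_restrict_Icc]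
    filter_upwards [h1, ae_eq_leftTrace hc hZ h t] with ζ e1 e2
    rw [← e1, e2]
  have h4 := Measure.eqOn_Icc_of_ae_eq volume zero_ne_one h3
    (continuous_const.add (continuous_primitiveCLM _)).continuousOn
    (Continuous.continuousOn (by fun_prop))
  rw [h2]
  simpa using h4 (right_mem_Icc.2 zero_le_one)

end transport

namespace PHSystem

variable {q p m : ℕ} {S : PHSystem q p m}

lemma mulVecCLM_injective {n : ℕ} {K : Matrix (Fin n) (Fin n) ℂ} (hK : IsUnit K.det) :
    Function.Injective (mulVecCLM K) := by
  intro x y hxy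
  have := congrArg WithLp.ofLp hxy
  rw [ofLp_mulVecCLM, ofLp_mulVecCLM] at this
  exact WithLp.ofLp_injective 2
    (Matrix.mulVec_injective_iff_isUnit.2 ((Matrix.isUnit_iff_isUnit_det K).2 hK) this)

/-- The traces of `∫₀ᵗ z` satisfy `K a(t) + L b(t) = 0` and `b(t) = a(t - λ₀⁻¹)`. Starting from `a =
0` at nonpositive times, invertibility of `K` propagates `a = 0` over successive intervals of length
`λ₀⁻¹`. -/
theorem IsMildSolution.eq_zero (hlam : 0 < S.lam) (hK : IsUnit S.K.det)
    {u : ℝ → CVec p} {z : ℝ → L2Unit (q + p)} {y : ℝ → CVec m}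
    (h : S.IsMildSolution 0 u z y) (hu : u =ᵐ[volume.restrict (Ioi (0 : ℝ))] 0) :
    EqOn z 0 (Ici 0) ∧ y =ᵐ[volume.restrict (Ioi (0 : ℝ))] 0 := by
  have hl : (S.lam : ℂ) ≠ 0 := by exact_mod_cast hlam.ne'
  obtain ⟨-, hy, hz, hz0, hmild⟩ := isMildSolution_iff.1 h
  -- Since `z(0) = 0`, extending by zero to negative times stays continuous. The transport lemmas
  -- then apply on all of `ℝ`, including characteristics that start before time `0`.
  let Z : ℝ → L2Unit (q + p) := fun t => z (max t 0)
  have hZ : Continuous Z := hz.comp_continuous (by fun_prop) fun t => le_max_right t 0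
  have hZneg : ∀ t ≤ 0, Z t = 0 := fun t ht => by simp [Z, max_eq_right ht, hz0]
  have hint : ∀ t, 0 ≤ t → ∫ s in (0 : ℝ)..t, Z s = ∫ s in (0 : ℝ)..t, z s := fun t ht =>
    intervalIntegral.integral_congr fun s hs => by
      rw [uIcc_of_le ht] at hs
      simp [Z, max_eq_left hs.1]
  have hex : ∀ t, ∃ ab : CVec (q + p) × CVec (q + p),
      IsH1With (∫ s in (0 : ℝ)..t, Z s) ((-(S.lam : ℂ)⁻¹) • Z t) ab.1 ab.2 ∧
      mulVecCLM S.K ab.1 + mulVecCLM S.L ab.2 = 0 ∧ (t ≤ 0 → ab.1 = 0) ∧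
      (0 ≤ t → (∫ s in (0 : ℝ)..t, y s)
        = (-(S.lam : ℂ)) • mulVecCLM S.Ky ab.1 - (S.lam : ℂ) • mulVecCLM S.Ly ab.2) := by
    intro t
    rcases lt_or_ge 0 t with ht | ht
    · obtain ⟨w', a, b, e1, e2, e3, e4⟩ := hmild t ht.le
      refine ⟨(a, b), ?_, ?_, fun h => absurd h (not_le.2 ht), fun _ => e4⟩
      · have : w' = (-(S.lam : ℂ)⁻¹) • Z t := by
          simp only [Z, max_eq_left ht.le]
          rw [sub_zero] at e2
          rw [e2, smul_smul, neg_mul_neg, inv_mul_cancel₀ hl, one_smul]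
        rw [hint t ht.le, ← this]; exact e1
      · rw [intervalIntegral_congr_of_ae_Ioi hu ht.le] at e3
        simp only [Pi.zero_apply, intervalIntegral.integral_zero, map_zero] at e3
        have : (-(S.lam : ℂ)) • (mulVecCLM S.K a + mulVecCLM S.L b) = 0 := by
          rw [e3, smul_add, neg_smul, neg_smul]; abel
        exact (smul_eq_zero.1 this).resolve_left (neg_ne_zero.2 hl)
    · have : ∫ s in (0 : ℝ)..t, Z s = 0 := by
        rw [intervalIntegral.integral_symm, intervalIntegral.integral_congr (g := 0)]
        · simp
        · intro s hs
          rw [uIcc_of_le ht] at hs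
          exact hZneg s hs.2
      refine ⟨0, ?_, by simp, by simp, fun ht' => ?_⟩
      · rw [this, hZneg t ht, smul_zero]; exact IsH1With.zero
      · simp [le_antisymm ht ht']
  choose ab hH hbc hneg hout using hex
  have hba := rightTrace_eq_leftTrace hlam hZ (a := fun t => (ab t).1) (b := fun t => (ab t).2) hH
  have hzero : ∀ k : ℕ, ∀ t : ℝ, t ≤ k * S.lam⁻¹ → (ab t).1 = 0 := by
    intro k
    induction k with
    | zero => intro t ht; exact hneg t (by simpa using ht)
    | succ k ih =>
      intro t ht
      have h1 : (ab t).2 = 0 := by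
        rw [hba t]; exact ih _ (by push_cast at ht; linarith)
      have h2 := hbc t
      rw [h1, map_zero, add_zero] at h2
      exact mulVecCLM_injective hK (h2.trans (map_zero _).symm)
  have ha : ∀ t, (ab t).1 = 0 := fun t => by
    obtain ⟨k, hk⟩ := exists_nat_ge (t * S.lam)
    exact hzero k t (by rw [← div_eq_mul_inv, le_div_iff₀ hlam]; exact hk)
  have hb : ∀ t, (ab t).2 = 0 := fun t => by rw [hba t]; exact ha _
  have hW : ∀ t, ∫ s in (0 : ℝ)..t, Z s = 0 := fun t => by
    have := ae_eq_leftTrace hlam hZ (a := fun t => (ab t).1) (b := fun t => (ab t).2) hH t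
    simp only [ha] at this
    exact Lp.ext (this.trans (Lp.coeFn_zero _ _ _).symm)
  constructor
  · intro t ht
    have h1 := (hZ.integral_hasStrictDerivAt 0 t).hasDerivAt
    simp only [hW] at h1
    have := h1.unique (hasDerivAt_const t 0)
    simpa [Z, max_eq_left (mem_Ici.1 ht)] using this
  · refine hy.ae_eq_zero fun t ht => ?_
    rw [hout t ht, ha, hb]; simp

theorem IsMildSolution.unique (hlam : 0 < S.lam) (hK : IsUnit S.K.det) {z₀ : L2Unit (q + p)}
    {u u' : ℝ → CVec p} {z z' : ℝ → L2Unit (q + p)} {y y' : ℝ → CVec m}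
    (h : S.IsMildSolution z₀ u z y) (h' : S.IsMildSolution z₀ u' z' y')
    (hu : u =ᵐ[volume.restrict (Ioi (0 : ℝ))] u') :
    EqOn z z' (Ici 0) ∧ y =ᵐ[volume.restrict (Ioi (0 : ℝ))] y' := by
  have hs := h.sub h'
  rw [sub_self] at hs
  obtain ⟨h1, h2⟩ := hs.eq_zero hlam hK (by
    filter_upwards [hu] with t ht using by simp [ht])
  refine ⟨fun t ht => sub_eq_zero.1 (h1 ht), ?_⟩
  filter_upwards [h2] with t ht using sub_eq_zero.1 ht

end PHSystem

/-! ### Affine changes of variables -/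

lemma map_affine_volume {a : ℝ} (ha : a ≠ 0) (e : ℝ) :
    Measure.map (fun s => e + a * s) (volume : Measure ℝ) = ENNReal.ofReal |a⁻¹| • volume := by
  have h : (fun s => e + a * s) = (fun s => e + s) ∘ fun s => a * s := rfl
  rw [h, ← Measure.map_map (by fun_prop) (by fun_prop), Real.map_volume_mul_left ha,
    Measure.map_smul, map_add_left_eq_self]

lemma memLp_comp_affine {E : Type*} [NormedAddCommGroup E] {g : ℝ → E} {A B : Set ℝ}
    (hA : MeasurableSet A) {a : ℝ} (ha : a ≠ 0) (e : ℝ)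
    (hg : MemLp g 2 (volume.restrict A)) (hBA : ∀ s ∈ B, e + a * s ∈ A) :
    MemLp (fun s => g (e + a * s)) 2 (volume.restrict B) := by
  have hm : Measurable fun s : ℝ => e + a * s := by fun_prop
  have h1 : MemLp g 2 (Measure.map (fun s => e + a * s)
      (volume.restrict ((fun s => e + a * s) ⁻¹' A))) := by
    rw [← Measure.restrict_map hm hA, map_affine_volume ha, Measure.restrict_smul]
    exact hg.smul_measure ENNReal.ofReal_ne_top
  exact (h1.comp_of_map hm.aemeasurable).mono_measure (Measure.restrict_mono hBA le_rfl)

lemma ae_comp_affine {P : ℝ → Prop} {a : ℝ} (ha : a ≠ 0) (e : ℝ) (h : ∀ᵐ s, P s) :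
    ∀ᵐ x : ℝ, P (e + a * x) := by
  have hm : Measurable fun s : ℝ => e + a * s := by fun_prop
  refine ae_of_ae_map (f := fun s => e + a * s) hm.aemeasurable ?_
  rw [map_affine_volume ha]
  exact Measure.ae_smul_measure h _

/-! ### Travelling waves -/

section travelWave

variable {d : ℕ} {ψ : ℝ → CVec d}

lemma memLp_translate (hψ : ∀ r, MemLp ψ 2 (volume.restrict (Ioi r))) (s : ℝ) :
    MemLp (fun ζ => ψ (ζ - s)) 2 unitMeasure := by
  have := memLp_comp_affine (B := Ioo (0 : ℝ) 1) measurableSet_Ioi one_ne_zero (-s)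
    (hψ (-s)) fun ζ hζ => by simpa using hζ.1
  refine this.congr_norm ?_ ?_
  · exact this.aestronglyMeasurable.congr (Filter.Eventually.of_forall fun ζ => by
      simp only [one_mul]; congr 1; ring)
  · exact Filter.Eventually.of_forall fun ζ => by
      simp only [one_mul]; congr 2; ring

/-- The profile `ψ`, shifted by `s` and restricted to the unit interval. -/
def travelWave (hψ : ∀ r, MemLp ψ 2 (volume.restrict (Ioi r))) (s : ℝ) : L2Unit d :=
  (memLp_translate hψ s).toLp _

lemma coeFn_travelWave (hψ : ∀ r, MemLp ψ 2 (volume.restrict (Ioi r)))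
    (s : ℝ) : travelWave hψ s =ᵐ[unitMeasure] fun ζ => ψ (ζ - s) :=
  MemLp.coeFn_toLp _

/-- Translations act continuously on `L²(ℝ)`, and restriction to the unit interval is continuous. -/
lemma continuous_travelWave (hψ : ∀ r, MemLp ψ 2 (volume.restrict (Ioi r)))
    : Continuous (travelWave hψ) := by
  rw [continuous_iff_continuousAt]
  intro s₀
  have : Fact ((2 : ENNReal) ≠ ⊤) := ⟨by norm_num⟩
  -- The profile need not be square integrable near `-∞`. For `s < N` and `ζ > 0` the argument `ζ -
  -- s` exceeds `-N`, so near `s₀` cutting the profile off at `-N` does not change the wave.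
  let N := s₀ + 1
  have hN : MemLp ((Ioi (-N)).indicator ψ) 2 volume :=
    (memLp_indicator_iff_restrict measurableSet_Ioi).2 (hψ (-N))
  let R := LpToLpRestrictCLM ℝ (CVec d) ℂ volume 2 (Ioo (0 : ℝ) 1)
  have hcont : Continuous fun s : ℝ => R (DomAddAct.mk (-s) +ᵥ hN.toLp _) := by
    refine R.continuous.comp ?_
    have : Continuous fun s : ℝ => DomAddAct.mk (-s) :=
      DomAddAct.continuous_mk.comp continuous_neg
    exact this.vadd continuous_const
  refine hcont.continuousAt.congr ?_
  filter_upwards [Iio_mem_nhds (show s₀ < N by simp [N])] with s hs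
  refine Lp.ext ?_
  filter_upwards [LpToLpRestrictCLM_coeFn ℂ (Ioo (0 : ℝ) 1) (DomAddAct.mk (-s) +ᵥ hN.toLp _),
    coeFn_travelWave hψ s,
    ae_restrict_of_ae (MemLp.coeFn_toLp (hN.comp_measurePreserving
      (measurePreserving_vadd (-s) volume))), ae_restrict_mem measurableSet_Ioo] with ζ h1 h2 h3 h4
  rw [h1, h2, DomAddAct.mk_vadd_toLp]
  refine h3.trans ?_
  simp only [Function.comp_apply, vadd_eq_add]
  rw [neg_add_eq_sub, indicator_of_mem]
  rw [mem_Ioi]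
  have := mem_Iio.1 hs
  linarith [h4.1]


lemma intervalIntegrable_of_memLp_Ioi (hψ : ∀ r, MemLp ψ 2 (volume.restrict (Ioi r)))
    (a b : ℝ) : IntervalIntegrable ψ volume a b := by
  rw [intervalIntegrable_iff]
  have : MemLp ψ 2 (volume.restrict (Ioc (min a b) (max a b))) :=
    (hψ (min a b)).mono_measure (Measure.restrict_mono (fun x hx => hx.1) le_rfl)
  exact this.integrable (by norm_num)

lemma continuous_profilePrimitive (hψ : ∀ r, MemLp ψ 2 (volume.restrict (Ioi r)))
    : Continuous fun x : ℝ => ∫ r in (0 : ℝ)..x, ψ r :=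
  intervalIntegral.continuous_primitive (intervalIntegrable_of_memLp_Ioi hψ) 0

lemma integral_profile_translate (hψ : ∀ r, MemLp ψ 2 (volume.restrict (Ioi r)))
    (a b s : ℝ) :
    ∫ x in a..b, ψ (x - s) = (∫ r in (0 : ℝ)..(b - s), ψ r) - ∫ r in (0 : ℝ)..(a - s), ψ r := by
  rw [intervalIntegral.integral_comp_sub_right, intervalIntegral.integral_interval_sub_left
    (intervalIntegrable_of_memLp_Ioi hψ _ _) (intervalIntegrable_of_memLp_Ioi hψ _ _)]

lemma integral_profile_reflect (hψ : ∀ r, MemLp ψ 2 (volume.restrict (Ioi r)))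
    {c : ℝ} (hc : 0 < c) (e t : ℝ) :
    ∫ s in (0 : ℝ)..t, ψ (e - c * s) =
      c⁻¹ • ((∫ r in (0 : ℝ)..e, ψ r) - ∫ r in (0 : ℝ)..(e - c * t), ψ r) := by
  rw [intervalIntegral.integral_comp_sub_mul _ hc.ne', mul_zero, sub_zero,
    intervalIntegral.integral_interval_sub_left
    (intervalIntegrable_of_memLp_Ioi hψ _ _) (intervalIntegrable_of_memLp_Ioi hψ _ _)]

lemma primitiveCLM_travelWave (hψ : ∀ r, MemLp ψ 2 (volume.restrict (Ioi r)))
    {ζ : ℝ} (hζ : ζ ∈ Icc (0 : ℝ) 1) (s : ℝ) :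
    primitiveCLM ζ (travelWave hψ s) =
      (∫ r in (0 : ℝ)..(ζ - s), ψ r) - ∫ r in (0 : ℝ)..(-s), ψ r := by
  rw [primitiveCLM_eq_of_ae hζ (coeFn_travelWave hψ s), integral_profile_translate hψ, zero_sub]

/-- Instead of exchanging the integrals in `s` and `x`, a second antiderivative `Θ` of the profile
is used: the integrand in `s` is an exact derivative. -/
lemma primitiveCLM_integral_travelWave (hψ : ∀ r, MemLp ψ 2 (volume.restrict (Ioi r)))
    {c : ℝ} (hc : 0 < c) (t : ℝ) {ζ : ℝ}
    (hζ : ζ ∈ Icc (0 : ℝ) 1) :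
    primitiveCLM ζ (∫ s in (0 : ℝ)..t, travelWave hψ (c * s)) =
      ∫ x in (0 : ℝ)..ζ, c⁻¹ • ((∫ r in (0 : ℝ)..x, ψ r) - ∫ r in (0 : ℝ)..(x - c * t), ψ r) := by
  let Ψ : ℝ → CVec d := fun x => ∫ r in (0 : ℝ)..x, ψ r
  have hΨ : Continuous Ψ := continuous_profilePrimitive hψ
  have htw : Continuous fun s => travelWave hψ (c * s) :=
    (continuous_travelWave hψ).comp (by fun_prop)
  have hcomm := ((primitiveCLM (d := d) ζ)).intervalIntegral_comp_comm
    (htw.intervalIntegrable (μ := volume) 0 t)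
  rw [← hcomm]
  let Θ : ℝ → CVec d := fun y => ∫ x in (0 : ℝ)..y, Ψ x
  have hΘ : ∀ y, HasDerivAt Θ (Ψ y) y := fun y => (hΨ.integral_hasStrictDerivAt 0 y).hasDerivAt
  have hg : ∀ s, HasDerivAt (fun s => c⁻¹ • (Θ ζ - (Θ (ζ - c * s) - Θ (0 - c * s))))
      (primitiveCLM ζ (travelWave hψ (c * s))) s := by
    intro s
    have haff : ∀ e : ℝ, HasDerivAt (fun s => e - c * s) (-c) s := fun e => by
      simpa using ((hasDerivAt_id s).const_mul c).const_sub e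
    have h1 := fun e => (hΘ (e - c * s)).scomp s (haff e)
    have h2 := (((h1 ζ).sub (h1 0)).const_sub (Θ ζ)).const_smul c⁻¹
    refine h2.congr_deriv ?_
    rw [primitiveCLM_travelWave hψ hζ, ← smul_sub, neg_smul, neg_neg, smul_smul,
      inv_mul_cancel₀ hc.ne', one_smul, zero_sub]
  rw [intervalIntegral.integral_eq_sub_of_hasDerivAt (fun s _ => hg s)
    (((primitiveCLM (d := d) ζ).continuous.comp htw).intervalIntegrable _ _)]
  have hsub : Continuous fun x => Ψ (x - c * t) := hΨ.comp (by fun_prop)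
  rw [intervalIntegral.integral_smul, intervalIntegral.integral_sub
    (hΨ.intervalIntegrable _ _) (hsub.intervalIntegrable _ _),
    intervalIntegral.integral_comp_sub_right Ψ]
  have e1 : Θ ζ - Θ 0 = Θ ζ := by simp [Θ]
  have e2 : Θ (ζ - c * t) - Θ (0 - c * t) = ∫ x in (0 - c * t)..(ζ - c * t), Ψ x :=
    intervalIntegral.integral_interval_sub_left (hΨ.intervalIntegrable _ _)
      (hΨ.intervalIntegrable _ _)
  have e3 : Θ 0 = 0 := by simp [Θ]
  rw [mul_zero, sub_zero, sub_zero, e3, sub_zero, sub_self, smul_zero, sub_zero, e2]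

lemma isH1With_integral_travelWave (hψ : ∀ r, MemLp ψ 2 (volume.restrict (Ioi r)))
    {c : ℝ} (hc : 0 < c) (t : ℝ) :
    IsH1With (∫ s in (0 : ℝ)..t, travelWave hψ (c * s))
      ((-(c : ℂ)⁻¹) • (travelWave hψ (c * t) - travelWave hψ 0))
      (∫ s in (0 : ℝ)..t, ψ (0 - c * s)) (∫ s in (0 : ℝ)..t, ψ (1 - c * s)) := by
  let Ψ : ℝ → CVec d := fun x => ∫ r in (0 : ℝ)..x, ψ r
  have hΨ : Continuous Ψ := continuous_profilePrimitive hψ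
  have hsub : Continuous fun x => Ψ (x - c * t) := hΨ.comp (by fun_prop)
  have key : ∀ ζ ∈ Icc (0 : ℝ) 1, (∫ s in (0 : ℝ)..t, ψ (0 - c * s)) + primitiveCLM ζ
      ((-(c : ℂ)⁻¹) • (travelWave hψ (c * t) - travelWave hψ 0)) =
      c⁻¹ • ((∫ r in (0 : ℝ)..ζ, ψ r) - ∫ r in (0 : ℝ)..(ζ - c * t), ψ r) := by
    intro ζ hζ
    rw [map_smul, map_sub, primitiveCLM_travelWave hψ hζ, primitiveCLM_travelWave hψ hζ,
      integral_profile_reflect hψ hc, ← Complex.ofReal_inv, neg_smul, Complex.coe_smul, ← sub_eq_add_neg,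
      ← smul_sub]
    congr 1
    simp only [zero_sub, sub_zero, neg_zero, intervalIntegral.integral_same]
    abel
  rw [IsH1With.iff_primitive]
  constructor
  · have := ae_eq_of_primitiveCLM_eq (f := ∫ s in (0 : ℝ)..t, travelWave hψ (c * s))
      (((hΨ.sub hsub).const_smul c⁻¹).intervalIntegrable _ _)
      fun ζ hζ => primitiveCLM_integral_travelWave hψ hc t hζ
    filter_upwards [this, ae_restrict_mem measurableSet_Ioo] with ζ h1 h2
    rw [h1, key ζ (Ioo_subset_Icc_self h2)]; rfl
  · rw [key 1 (by simp), integral_profile_reflect hψ hc]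

end travelWave

/-! ### Boundary values of travelling waves -/

namespace PHSystem

variable {q p m : ℕ} {S : PHSystem q p m}

/-- The boundary observation `-lam P z(0,t) - lam Q z(1,t)` of the travelling wave with
profile `ψ`. -/
def boundaryTrace {n k : ℕ} (c : ℝ) (P Q : Matrix (Fin k) (Fin n) ℂ) (ψ : ℝ → CVec n) (s : ℝ) :
    CVec k :=
  (-(c : ℂ)) • mulVecCLM P (ψ (0 - c * s)) - (c : ℂ) • mulVecCLM Q (ψ (1 - c * s))

section boundaryTrace

variable {n k : ℕ} {c : ℝ} (P Q : Matrix (Fin k) (Fin n) ℂ) {ψ : ℝ → CVec n}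

lemma memLp_profile_reflect (hψ : ∀ r, MemLp ψ 2 (volume.restrict (Ioi r)))
    (hc : 0 < c) (e T : ℝ) :
    MemLp (fun s => ψ (e - c * s)) 2 (volume.restrict (Ioo 0 T)) := by
  have := memLp_comp_affine (B := Ioo (0 : ℝ) T) measurableSet_Ioi (neg_ne_zero.2 hc.ne') e
    (hψ (e - c * T)) fun s hs => by
      have : c * s < c * T := by gcongr; exact hs.2
      rw [mem_Ioi]; linarith
  simpa only [neg_mul, ← sub_eq_add_neg] using this

lemma isL2Loc_boundaryTrace (hψ : ∀ r, MemLp ψ 2 (volume.restrict (Ioi r)))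
    (hc : 0 < c) : IsL2Loc (boundaryTrace c P Q ψ) := fun T _ =>
  (((mulVecCLM P).comp_memLp' (memLp_profile_reflect hψ hc 0 T)).const_smul (-(c : ℂ))).sub
    (((mulVecCLM Q).comp_memLp' (memLp_profile_reflect hψ hc 1 T)).const_smul (c : ℂ))

lemma integral_boundaryTrace (hψ : ∀ r, MemLp ψ 2 (volume.restrict (Ioi r)))
    (hc : 0 < c) {t : ℝ} (ht : 0 ≤ t) :
    ∫ s in (0 : ℝ)..t, boundaryTrace c P Q ψ s =
      (-(c : ℂ)) • mulVecCLM P (∫ s in (0 : ℝ)..t, ψ (0 - c * s)) -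
        (c : ℂ) • mulVecCLM Q (∫ s in (0 : ℝ)..t, ψ (1 - c * s)) := by
  have hint : ∀ e, IntervalIntegrable (fun s => ψ (e - c * s)) volume 0 t := fun e => by
    rw [intervalIntegrable_iff_integrableOn_Ioo_of_le ht]
    exact (memLp_profile_reflect hψ hc e t).integrable (by norm_num)
  have hint' : ∀ (M : CVec n →L[ℂ] CVec k) (e : ℝ),
      IntervalIntegrable (fun s => M (ψ (e - c * s))) volume 0 t := fun M e =>
    ⟨M.integrable_comp (hint e).1, M.integrable_comp (hint e).2⟩
  have hP := ((-(c : ℂ)) • mulVecCLM P).intervalIntegral_comp_comm (hint 0)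
  have hQ := ((c : ℂ) • mulVecCLM Q).intervalIntegral_comp_comm (hint 1)
  rw [smul_apply] at hP hQ
  rw [← hP, ← hQ, ← intervalIntegral.integral_sub
    (hint' ((-(c : ℂ)) • mulVecCLM P) 0)
    (hint' ((c : ℂ) • mulVecCLM Q) 1)]
  rfl

end boundaryTrace

theorem isMildSolution_travelWave (hlam : 0 < S.lam) {ψ : ℝ → CVec (q + p)}
    (hψ : ∀ r, MemLp ψ 2 (volume.restrict (Ioi r))) {u : ℝ → CVec p} (hu : IsL2Loc u)
    (hbc : ∀ s, 0 < s → embLast q p (u s) = boundaryTrace S.lam S.K S.L ψ s) :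
    S.IsMildSolution (travelWave hψ 0) u (fun t => travelWave hψ (S.lam * t))
      (boundaryTrace S.lam S.Ky S.Ly ψ) := by
  have hl : (S.lam : ℂ) ≠ 0 := by exact_mod_cast hlam.ne'
  rw [isMildSolution_iff]
  have hz : Continuous fun t => travelWave hψ (S.lam * t) :=
    (continuous_travelWave hψ).comp (by fun_prop)
  have hz0 : travelWave hψ (S.lam * 0) = travelWave hψ 0 := by rw [mul_zero]
  have hyL2 := isL2Loc_boundaryTrace S.Ky S.Ly hψ hlam
  refine ⟨hu, hyL2, ?_, ?_, ?_⟩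
  · exact hz.continuousOn
  · exact hz0
  intro t ht
  have hy := integral_boundaryTrace S.Ky S.Ly hψ hlam ht
  have hu' := integral_boundaryTrace S.K S.L hψ hlam ht
  have hH := isH1With_integral_travelWave hψ hlam t
  refine ⟨_, _, _, hH, ?_, ?_, hy⟩
  · rw [smul_smul, neg_mul_neg, mul_inv_cancel₀ hl, one_smul]
  · rw [← hu', ← (embLast q p).intervalIntegral_comp_comm (hu.intervalIntegrable ht)]
    refine intervalIntegral_congr_of_ae_Ioi ?_ ht
    filter_upwards [ae_restrict_mem measurableSet_Ioi] with s hs using hbc s hs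

end PHSystem

/-! ### The delay equation for the profile -/

section delay

variable {d : ℕ}

/-- The solution of `ψ x = A (ψ (x + 1)) + f x` after `k` steps. -/
def delayIterate (A : CVec d →L[ℂ] CVec d) (f g : ℝ → CVec d) : ℕ → ℝ → CVec d
  | 0 => g
  | k + 1 => fun x => A (delayIterate A f g k (x + 1)) + f x

/-- The function with `ψ = g` on `[0,∞)` and `ψ x = A (ψ (x + 1)) + f x` for `x < 0`. -/
def delayProfile (A : CVec d →L[ℂ] CVec d) (f g : ℝ → CVec d) (x : ℝ) : CVec d :=
  delayIterate A f g ⌈-x⌉₊ x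

lemma delayProfile_of_nonneg (A : CVec d →L[ℂ] CVec d) (f g : ℝ → CVec d) {x : ℝ} (hx : 0 ≤ x) :
    delayProfile A f g x = g x := by
  rw [delayProfile, Nat.ceil_eq_zero.2 (by linarith)]; rfl

lemma delayProfile_of_neg (A : CVec d →L[ℂ] CVec d) (f g : ℝ → CVec d) {x : ℝ} (hx : x < 0) :
    delayProfile A f g x = A (delayProfile A f g (x + 1)) + f x := by
  -- A shift by one uses up exactly one step of the recursion; the truncated ceiling makes this
  -- valid also for `-1 ≤ x < 0`.
  have h : ⌈-x⌉₊ = ⌈-(x + 1)⌉₊ + 1 := by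
    have h1 : 0 < ⌈-x⌉₊ := Nat.ceil_pos.2 (by linarith)
    rw [neg_add, ← sub_eq_add_neg, Nat.ceil_sub_one]; omega
  rw [delayProfile, h]; rfl

/-- The recursion carries square integrability from `(-k, ∞)` to `(-k-1, 0)`; this is glued to the
given part on `[0, ∞)`. -/
lemma memLp_delayProfile (A : CVec d →L[ℂ] CVec d) {f g : ℝ → CVec d}
    (hf : ∀ r, MemLp f 2 (volume.restrict (Ioo r 0))) (hg : MemLp g 2 (volume.restrict (Ici 0)))
    (r : ℝ) : MemLp (delayProfile A f g) 2 (volume.restrict (Ioi r)) := by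
  set ψ := delayProfile A f g with hψ
  have hpos : MemLp ψ 2 (volume.restrict (Ici 0)) := by
    refine (memLp_congr_ae ?_).2 hg
    filter_upwards [ae_restrict_mem measurableSet_Ici] with x hx
    exact delayProfile_of_nonneg A f g hx
  have key : ∀ k : ℕ, MemLp ψ 2 (volume.restrict (Ioi (-(k : ℝ)))) := by
    intro k
    induction k with
    | zero =>
      exact hpos.mono_measure (Measure.restrict_mono (fun x hx => by
        simpa using (mem_Ioi.1 hx).le) le_rfl)
    | succ k ih =>
      have hneg : MemLp ψ 2 (volume.restrict (Ioo (-((k + 1 : ℕ) : ℝ)) 0)) := by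
        have h1 := memLp_comp_affine (B := Ioo (-((k + 1 : ℕ) : ℝ)) 0) measurableSet_Ioi
          one_ne_zero 1 ih fun s hs => by
            have := hs.1
            push_cast at this
            rw [mem_Ioi]; linarith
        refine (memLp_congr_ae ?_).2 ((A.comp_memLp' h1).add (hf _))
        filter_upwards [ae_restrict_mem measurableSet_Ioo] with x hx
        rw [hψ, delayProfile_of_neg A f g hx.2, Pi.add_apply, Function.comp_apply, one_mul,
          add_comm x]
      have h := MemLp.piecewise (μ := volume.restrict (Ioi (-((k + 1 : ℕ) : ℝ)))) (p := 2)
        (f := ψ) (g := ψ) (measurableSet_Ici (a := (0 : ℝ)))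
        (hpos.mono_measure (Measure.restrict_mono_measure Measure.restrict_le_self _))
        (hneg.mono_measure (by
          rw [Measure.restrict_restrict measurableSet_Ici.compl]
          exact Measure.restrict_mono (by rintro x ⟨h1, h2⟩; exact ⟨h2, not_le.1 h1⟩) le_rfl))
      rwa [piecewise_same] at h
  obtain ⟨k, hk⟩ := exists_nat_ge (-r)
  exact (key k).mono_measure (Measure.restrict_mono (Ioi_subset_Ioi (by linarith)) le_rfl)

lemma intervalIntegrable_norm_sq {f : ℝ → CVec d} {a b : ℝ} (hab : a ≤ b)
    (hf : MemLp f 2 (volume.restrict (Ioo a b))) :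
    IntervalIntegrable (fun x => ‖f x‖ ^ 2) volume a b := by
  rw [intervalIntegrable_iff_integrableOn_Ioo_of_le hab]
  exact hf.integrable_norm_pow (by norm_num)

lemma norm_add_sq_le {E : Type*} [SeminormedAddCommGroup E] (x y : E) :
    ‖x + y‖ ^ 2 ≤ 2 * ‖x‖ ^ 2 + 2 * ‖y‖ ^ 2 := by
  have h1 : ‖x + y‖ ^ 2 ≤ (‖x‖ + ‖y‖) ^ 2 := by gcongr; exact norm_add_le x y
  nlinarith [sq_nonneg (‖x‖ - ‖y‖)]

lemma norm_map_sq_le {a b : ℕ} (A : CVec a →L[ℂ] CVec b) (x : CVec a) :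
    ‖A x‖ ^ 2 ≤ ‖A‖ ^ 2 * ‖x‖ ^ 2 := by
  rw [← mul_pow]; gcongr; exact A.le_opNorm x

/-- On `(-r, 0)` the recursion bounds `ψ` by its values on `(1-r, 1)`, which are covered by the
previous step. The constant depends only on `A` and `k`, so the estimate is uniform in the data. -/
lemma exists_delay_bound (A : CVec d →L[ℂ] CVec d) (k : ℕ) : ∃ M : ℝ, 0 ≤ M ∧
    ∀ f ψ : ℝ → CVec d, (∀ r, MemLp f 2 (volume.restrict (Ioo r 0))) →
      (∀ r, MemLp ψ 2 (volume.restrict (Ioi r))) →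
      (∀ x < 0, ψ x = A (ψ (x + 1)) + f x) → ∀ r ∈ Icc (0 : ℝ) k,
      ∫ x in (-r)..1, ‖ψ x‖ ^ 2 ≤ M * ((∫ x in (0 : ℝ)..1, ‖ψ x‖ ^ 2) + ∫ x in (-r)..0, ‖f x‖ ^ 2)
    := by
  induction k with
  | zero =>
    refine ⟨1, zero_le_one, fun f ψ _ _ _ r hr => ?_⟩
    have : r = 0 := le_antisymm (by simpa using hr.2) hr.1
    simp [this]
  | succ k ih =>
    obtain ⟨M, hM, h⟩ := ih
    -- The part over `(0,1)` contributes `F₀`, the recursion `2‖A‖² M (F₀ + U)`, and the forcing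
    -- `2U`.
    refine ⟨1 + 2 * ‖A‖ ^ 2 * M + 2, by positivity, fun f ψ hf hψ hrec r hr => ?_⟩
    have hψi : ∀ a b : ℝ, IntervalIntegrable (fun x => ‖ψ x‖ ^ 2) volume a b := fun a b => by
      have : ∀ a b : ℝ, a ≤ b → IntervalIntegrable (fun x => ‖ψ x‖ ^ 2) volume a b :=
        fun a b hab => intervalIntegrable_norm_sq hab
          ((hψ a).mono_measure (Measure.restrict_mono (fun x hx => hx.1) le_rfl))
      exact (le_total a b).elim (this a b) fun hab => (this b a hab).symm
    have hfi : ∀ a : ℝ, a ≤ 0 → IntervalIntegrable (fun x => ‖f x‖ ^ 2) volume a 0 :=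
      fun a ha => intervalIntegrable_norm_sq ha (hf a)
    set F₀ := ∫ x in (0 : ℝ)..1, ‖ψ x‖ ^ 2 with hF₀
    set U := ∫ x in (-r)..0, ‖f x‖ ^ 2 with hU
    have hF₀' : 0 ≤ F₀ := intervalIntegral.integral_nonneg zero_le_one fun _ _ => by positivity
    have hU' : 0 ≤ U := intervalIntegral.integral_nonneg (by linarith [hr.1]) fun _ _ => by positivity
    have hr0 : -r ≤ 0 := by linarith [hr.1]
    have h1 : ∫ x in (-r)..0, ‖ψ x‖ ^ 2 ≤
        2 * ‖A‖ ^ 2 * (∫ x in (1 - r)..1, ‖ψ x‖ ^ 2) + 2 * U := by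
      have hi1 : IntervalIntegrable (fun x => ‖ψ (x + 1)‖ ^ 2) volume (-r) 0 := by
        simpa using (hψi (-r + 1) 1).comp_add_right 1
      calc ∫ x in (-r)..0, ‖ψ x‖ ^ 2
          ≤ ∫ x in (-r)..0, (2 * ‖A‖ ^ 2 * ‖ψ (x + 1)‖ ^ 2 + 2 * ‖f x‖ ^ 2) := by
            refine intervalIntegral.integral_mono_on_of_le_Ioo hr0 (hψi _ _)
              ((hi1.const_mul _).add ((hfi _ hr0).const_mul _)) fun x hx => ?_
            rw [hrec x hx.2]
            nlinarith [norm_add_sq_le (A (ψ (x + 1))) (f x), norm_map_sq_le A (ψ (x + 1))]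
        _ = _ := by
            rw [intervalIntegral.integral_add (hi1.const_mul _) ((hfi _ hr0).const_mul _),
              intervalIntegral.integral_const_mul, intervalIntegral.integral_const_mul,
              intervalIntegral.integral_comp_add_right (fun x => ‖ψ x‖ ^ 2)]
            rw [neg_add_eq_sub, zero_add]
    -- For `r < 1` the shifted interval `(1-r, 1)` already lies in `(0,1)`, hence the truncation at
    -- `0`.
    set r' := max (r - 1) 0 with hr'
    have hr'k : r' ∈ Icc (0 : ℝ) k := by
      refine ⟨le_max_right _ _, max_le ?_ (Nat.cast_nonneg k)⟩
      have := hr.2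
      push_cast at this; linarith
    have hr'r : r' ≤ r := max_le (by linarith) hr.1
    have hr'1 : r - 1 ≤ r' := le_max_left _ _
    have h2 : ∫ x in (1 - r)..1, ‖ψ x‖ ^ 2 ≤ ∫ x in (-r')..1, ‖ψ x‖ ^ 2 :=
      intervalIntegral.integral_mono_interval (by linarith) (by linarith [hr.1]) le_rfl
        (Filter.Eventually.of_forall fun _ => by positivity) (hψi _ _)
    have h3 : ∫ x in (-r')..0, ‖f x‖ ^ 2 ≤ U :=
      intervalIntegral.integral_mono_interval (by linarith) (by linarith [hr'k.1]) le_rfl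
        (Filter.Eventually.of_forall fun _ => by positivity) (hfi _ hr0)
    have h4 := h f ψ hf hψ hrec r' hr'k
    have h5 : ∫ x in (1 - r)..1, ‖ψ x‖ ^ 2 ≤ M * (F₀ + U) :=
      h2.trans (h4.trans (by gcongr))
    have h6 : 2 * ‖A‖ ^ 2 * (∫ x in (1 - r)..1, ‖ψ x‖ ^ 2) ≤ 2 * ‖A‖ ^ 2 * (M * (F₀ + U)) := by
      gcongr
    rw [← intervalIntegral.integral_add_adjacent_intervals (hψi (-r) 0) (hψi 0 1)]
    calc _ ≤ 2 * ‖A‖ ^ 2 * (M * (F₀ + U)) + 2 * U + F₀ := by linarith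
      _ ≤ _ := by nlinarith

end delay

/-! ### Norms of travelling waves and the algebra of matrix operators -/

lemma L2Unit.norm_sq {d : ℕ} (f : L2Unit d) : ‖f‖ ^ 2 = ∫ x, ‖f x‖ ^ 2 ∂unitMeasure := by
  have h := congrArg RCLike.re (inner_self_eq_norm_sq_to_K (𝕜 := ℂ) f)
  rw [L2.inner_def] at h
  simp only [inner_self_eq_norm_sq_to_K] at h
  norm_cast at h
  exact h.symm

lemma norm_travelWave_sq {d : ℕ} {ψ : ℝ → CVec d}
    (hψ : ∀ r, MemLp ψ 2 (volume.restrict (Ioi r))) (s : ℝ) :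
    ‖travelWave hψ s‖ ^ 2 = ∫ x in (-s)..(1 - s), ‖ψ x‖ ^ 2 := by
  rw [L2Unit.norm_sq, ← zero_sub s,
    ← intervalIntegral.integral_comp_sub_right (fun x => ‖ψ x‖ ^ 2),
    intervalIntegral.integral_of_le zero_le_one, integral_Ioc_eq_integral_Ioo]
  refine integral_congr_ae ?_
  filter_upwards [coeFn_travelWave hψ s] with x hx
  rw [hx]

section mulVecCLM

variable {a b c : ℕ}

lemma mulVecCLM_mul (P : Matrix (Fin a) (Fin b) ℂ) (Q : Matrix (Fin b) (Fin c) ℂ) (x : CVec c) :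
    mulVecCLM (P * Q) x = mulVecCLM P (mulVecCLM Q x) :=
  WithLp.ofLp_injective 2 (by simp [Matrix.mulVec_mulVec])

lemma mulVecCLM_smul (r : ℂ) (P : Matrix (Fin a) (Fin b) ℂ) (x : CVec b) :
    mulVecCLM (r • P) x = r • mulVecCLM P x :=
  WithLp.ofLp_injective 2 (by simp [Matrix.smul_mulVec])

lemma mulVecCLM_neg (P : Matrix (Fin a) (Fin b) ℂ) (x : CVec b) :
    mulVecCLM (-P) x = -mulVecCLM P x :=
  WithLp.ofLp_injective 2 (by simp [Matrix.neg_mulVec])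

lemma mulVecCLM_sub (P Q : Matrix (Fin a) (Fin b) ℂ) (x : CVec b) :
    mulVecCLM (P - Q) x = mulVecCLM P x - mulVecCLM Q x :=
  WithLp.ofLp_injective 2 (by simp [Matrix.sub_mulVec])

@[simp] lemma mulVecCLM_one (x : CVec a) : mulVecCLM (1 : Matrix (Fin a) (Fin a) ℂ) x = x :=
  WithLp.ofLp_injective 2 (by simp)

@[simp] lemma mulVecCLM_zero (x : CVec b) : mulVecCLM (0 : Matrix (Fin a) (Fin b) ℂ) x = 0 :=
  WithLp.ofLp_injective 2 (by simp)

end mulVecCLM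

/-! ### Existence of mild solutions and well-posedness -/

namespace PHSystem

variable {q p m : ℕ} {S : PHSystem q p m}

lemma mulVecCLM_K_Ad (hK : IsUnit S.K.det) (x : CVec (q + p)) :
    mulVecCLM S.K (mulVecCLM S.Ad x) = -mulVecCLM S.L x := by
  rw [← mulVecCLM_mul, Ad, mul_neg, Matrix.mul_nonsing_inv_cancel_left _ _ hK, mulVecCLM_neg]

lemma mulVecCLM_K_Bd (hK : IsUnit S.K.det) (v : CVec p) :
    mulVecCLM S.K (mulVecCLM S.Bd v) = (-(S.lam : ℂ)⁻¹) • embLast q p v := by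
  rw [← mulVecCLM_mul, Bd, Matrix.mul_smul, Matrix.mul_nonsing_inv_cancel_left _ _ hK,
    mulVecCLM_smul]
  rfl

lemma mulVecCLM_Cd (x : CVec (q + p)) : mulVecCLM S.Cd x =
    (-(S.lam : ℂ)) • mulVecCLM S.Ky (mulVecCLM S.Ad x) - (S.lam : ℂ) • mulVecCLM S.Ly x := by
  rw [Cd, mulVecCLM_sub, mulVecCLM_smul, mulVecCLM_smul, mulVecCLM_mul]

lemma mulVecCLM_Dd (v : CVec p) : mulVecCLM S.Dd v =
    (-(S.lam : ℂ)) • mulVecCLM S.Ky (mulVecCLM S.Bd v) := by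
  rw [Dd, mulVecCLM_smul, mulVecCLM_mul]

/-- The mild solutions are travelling waves whose profile follows the discrete-time system. -/
theorem exists_travelWave_solution (hlam : 0 < S.lam) (hK : IsUnit S.K.det)
    (z₀ : L2Unit (q + p)) {u : ℝ → CVec p} (hu : IsL2Loc u) :
    ∃ (ψ : ℝ → CVec (q + p)) (hψ : ∀ r, MemLp ψ 2 (volume.restrict (Ioi r))),
      ψ =ᵐ[unitMeasure] z₀ ∧
      (∀ x < 0, ψ x = mulVecCLM S.Ad (ψ (x + 1)) + mulVecCLM S.Bd (u (0 + (-S.lam⁻¹) * x))) ∧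
      S.IsMildSolution z₀ u (fun t => travelWave hψ (S.lam * t))
        (boundaryTrace S.lam S.Ky S.Ly ψ) := by
  have hl : (S.lam : ℂ) ≠ 0 := by exact_mod_cast hlam.ne'
  let f : ℝ → CVec (q + p) := fun x => mulVecCLM S.Bd (u (0 + (-S.lam⁻¹) * x))
  -- Zero beyond the unit interval, so that `g` is square integrable on `[0, ∞)`; only its values on
  -- `(0,1)` enter the initial state.
  let g : ℝ → CVec (q + p) := (Ioo (0 : ℝ) 1).indicator z₀
  have hf : ∀ r, MemLp f 2 (volume.restrict (Ioo r 0)) := fun r => by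
    refine (mulVecCLM S.Bd).comp_memLp' (memLp_comp_affine measurableSet_Ioc
      (neg_ne_zero.2 (inv_pos.2 hlam).ne') 0 (hu.memLp (-S.lam⁻¹ * r)) fun s hs => ?_)
    have hi := inv_pos.2 hlam
    exact ⟨by nlinarith [hs.2], by nlinarith [hs.1]⟩
  have hg : MemLp g 2 (volume.restrict (Ici 0)) :=
    ((memLp_indicator_iff_restrict measurableSet_Ioo).2 (Lp.memLp z₀)).restrict _
  have hrec : ∀ x < 0, delayProfile (mulVecCLM S.Ad) f g x =
      mulVecCLM S.Ad (delayProfile (mulVecCLM S.Ad) f g (x + 1)) + f x := fun x hx =>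
    delayProfile_of_neg _ f g hx
  have hψ := memLp_delayProfile (mulVecCLM S.Ad) hf hg
  have hz₀ : delayProfile (mulVecCLM S.Ad) f g =ᵐ[unitMeasure] z₀ := by
    filter_upwards [ae_restrict_mem measurableSet_Ioo] with x hx
    rw [delayProfile_of_nonneg _ _ _ hx.1.le]
    exact indicator_of_mem hx _
  have htw : travelWave hψ 0 = z₀ := by
    refine Lp.ext ?_
    filter_upwards [coeFn_travelWave hψ 0, hz₀] with x h1 h2
    rw [h1, sub_zero, h2]
  refine ⟨delayProfile (mulVecCLM S.Ad) f g, hψ, hz₀, hrec, ?_⟩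
  have := isMildSolution_travelWave hlam hψ hu fun s hs => by
    have h1 := hrec (0 - S.lam * s) (by nlinarith)
    have h2 : f (0 - S.lam * s) = mulVecCLM S.Bd (u s) := by
      simp only [f]
      congr 2
      field_simp
      ring
    rw [boundaryTrace, h1, h2, map_add, mulVecCLM_K_Ad hK, mulVecCLM_K_Bd hK,
      show 0 - S.lam * s + 1 = 1 - S.lam * s by ring, smul_add, smul_smul, neg_mul_neg,
      mul_inv_cancel₀ hl, one_smul, smul_neg, neg_smul, neg_neg]
    abel
  rwa [htw] at this

theorem isWellPosed_of_isUnit_det (hlam : 0 < S.lam) (hK : IsUnit S.K.det) :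
    S.IsWellPosed := by
  refine ⟨fun z₀ u hu => ?_, fun z₀ u z₁ z₂ y₁ y₂ h₁ h₂ => h₁.unique hlam hK h₂ (ae_eq_refl _),
    fun T hT => ?_⟩
  · obtain ⟨ψ, hψ, -, -, h⟩ := exists_travelWave_solution hlam hK z₀ hu
    exact ⟨_, _, h⟩
  obtain ⟨k, hk⟩ := exists_nat_ge (S.lam * T)
  obtain ⟨M, hM, hbound⟩ := exists_delay_bound (mulVecCLM S.Ad) k
  let κ := ‖mulVecCLM S.Ky‖ ^ 2
  let ℓ := ‖mulVecCLM S.Ly‖ ^ 2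
  let β := ‖mulVecCLM S.Bd‖ ^ 2
  -- With `F` the energy of the profile on `(-λ₀t, 1)`, state and output together are at most `(1 +
  -- 2λ₀(κ+ℓ)) F`. The delay estimate bounds `F` by `M` times the initial energy plus the energy of
  -- the forcing, the latter being at most `λ₀β` times that of `u`.
  refine ⟨(1 + 2 * S.lam * (κ + ℓ)) * (M * (1 + S.lam * β)), fun z₀ u z y h t ht => ?_⟩
  obtain ⟨ψ, hψ, hψ0, hrec, hmild⟩ := exists_travelWave_solution hlam hK z₀ h.1
  obtain ⟨hz, hy⟩ := h.unique hlam hK hmild (ae_eq_refl _)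
  have hr : S.lam * t ∈ Icc (0 : ℝ) k :=
    ⟨mul_nonneg hlam.le ht.1, (mul_le_mul_of_nonneg_left ht.2 hlam.le).trans hk⟩
  have hf : ∀ r, MemLp (fun x => mulVecCLM S.Bd (u (0 + (-S.lam⁻¹) * x))) 2
      (volume.restrict (Ioo r 0)) := fun r => by
    refine (mulVecCLM S.Bd).comp_memLp' (memLp_comp_affine measurableSet_Ioc
      (neg_ne_zero.2 (inv_pos.2 hlam).ne') 0 (h.1.memLp (-S.lam⁻¹ * r)) fun s hs => ?_)
    have hi := inv_pos.2 hlam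
    exact ⟨by nlinarith [hs.2], by nlinarith [hs.1]⟩
  have hF := hbound _ ψ hf hψ hrec _ hr
  have hψi : ∀ a b : ℝ, IntervalIntegrable (fun x => ‖ψ x‖ ^ 2) volume a b := fun a b => by
    have : ∀ a b : ℝ, a ≤ b → IntervalIntegrable (fun x => ‖ψ x‖ ^ 2) volume a b :=
      fun a b hab => intervalIntegrable_norm_sq hab
        ((hψ a).mono_measure (Measure.restrict_mono (fun x hx => hx.1) le_rfl))
    exact (le_total a b).elim (this a b) fun hab => (this b a hab).symm
  have hz₀ : ∫ x in (0 : ℝ)..1, ‖ψ x‖ ^ 2 = ‖z₀‖ ^ 2 := by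
    rw [L2Unit.norm_sq, intervalIntegral.integral_of_le zero_le_one, integral_Ioc_eq_integral_Ioo]
    refine integral_congr_ae ?_
    filter_upwards [hψ0] with x hx
    rw [hx]
  have hU : ∫ x in (-(S.lam * t))..0, ‖mulVecCLM S.Bd (u (0 + (-S.lam⁻¹) * x))‖ ^ 2 ≤
      S.lam * β * ∫ s in (0 : ℝ)..t, ‖u s‖ ^ 2 := by
    have hsub := intervalIntegral.integral_comp_add_mul
      (a := -(S.lam * t)) (b := 0) (fun s => ‖mulVecCLM S.Bd (u s)‖ ^ 2)
      (neg_ne_zero.2 (inv_pos.2 hlam).ne') 0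
    have e : (0 : ℝ) + -S.lam⁻¹ * -(S.lam * t) = t := by field_simp; ring
    rw [hsub, e, mul_zero, add_zero, intervalIntegral.integral_symm, inv_neg, inv_inv, smul_neg,
      neg_smul, neg_neg, smul_eq_mul, mul_assoc, ← intervalIntegral.integral_const_mul β]
    refine mul_le_mul_of_nonneg_left ?_ hlam.le
    refine intervalIntegral.integral_mono_on ht.1 ?_ ((h.1.intervalIntegrable_sq ht.1).const_mul _)
      fun s _ => norm_map_sq_le _ _
    exact intervalIntegrable_norm_sq ht.1 ((mulVecCLM S.Bd).comp_memLp'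
      ((h.1.memLp t).mono_measure (Measure.restrict_mono Ioo_subset_Ioc_self le_rfl)))
  set F := ∫ x in (-(S.lam * t))..1, ‖ψ x‖ ^ 2 with hFdef
  have hmono : ∀ a b : ℝ, -(S.lam * t) ≤ a → a ≤ b → b ≤ 1 → ∫ x in a..b, ‖ψ x‖ ^ 2 ≤ F :=
    fun a b h1 h2 h3 => intervalIntegral.integral_mono_interval h1 h2 h3
      (Filter.Eventually.of_forall fun _ => by positivity) (hψi _ _)
  have hzF : ‖z t‖ ^ 2 ≤ F := by
    rw [hz (mem_Ici.2 ht.1), norm_travelWave_sq]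
    exact hmono _ _ le_rfl (by linarith) (by linarith [hr.1])
  have hyF : ∫ s in (0 : ℝ)..t, ‖y s‖ ^ 2 ≤ 2 * S.lam * (κ + ℓ) * F := by
    have hcongr : ∫ s in (0 : ℝ)..t, ‖y s‖ ^ 2 =
        ∫ s in (0 : ℝ)..t, ‖boundaryTrace S.lam S.Ky S.Ly ψ s‖ ^ 2 :=
      intervalIntegral_congr_of_ae_Ioi (by filter_upwards [hy] with s hs using by rw [hs]) ht.1
    have hint : ∀ e, IntervalIntegrable (fun s => ‖ψ (e - S.lam * s)‖ ^ 2) volume 0 t := fun e =>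
      intervalIntegrable_norm_sq ht.1 (memLp_profile_reflect hψ hlam e t)
    have hval : ∀ e, e ∈ Icc (0 : ℝ) 1 →
        ∫ s in (0 : ℝ)..t, ‖ψ (e - S.lam * s)‖ ^ 2 ≤ S.lam⁻¹ * F := fun e he => by
      rw [intervalIntegral.integral_comp_sub_mul (fun x => ‖ψ x‖ ^ 2) hlam.ne', mul_zero,
        sub_zero, smul_eq_mul]
      exact mul_le_mul_of_nonneg_left
        (hmono _ _ (by linarith [he.1]) (by linarith [hr.1]) he.2) (inv_pos.2 hlam).le
    rw [hcongr]
    calc ∫ s in (0 : ℝ)..t, ‖boundaryTrace S.lam S.Ky S.Ly ψ s‖ ^ 2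
        ≤ ∫ s in (0 : ℝ)..t, (2 * S.lam ^ 2 * κ * ‖ψ (0 - S.lam * s)‖ ^ 2 +
            2 * S.lam ^ 2 * ℓ * ‖ψ (1 - S.lam * s)‖ ^ 2) := by
          refine intervalIntegral.integral_mono_on ht.1
            ((isL2Loc_boundaryTrace S.Ky S.Ly hψ hlam).intervalIntegrable_sq ht.1)
            (((hint 0).const_mul _).add ((hint 1).const_mul _)) fun s _ => ?_
          have h1 := norm_add_sq_le ((-(S.lam : ℂ)) • mulVecCLM S.Ky (ψ (0 - S.lam * s)))
            (-((S.lam : ℂ) • mulVecCLM S.Ly (ψ (1 - S.lam * s))))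
          rw [← sub_eq_add_neg, norm_neg, norm_smul, norm_smul, norm_neg, mul_pow, mul_pow,
            Complex.norm_real, Real.norm_eq_abs, sq_abs] at h1
          have h2 := mul_le_mul_of_nonneg_left (norm_map_sq_le (mulVecCLM S.Ky)
            (ψ (0 - S.lam * s))) (sq_nonneg S.lam)
          have h3 := mul_le_mul_of_nonneg_left (norm_map_sq_le (mulVecCLM S.Ly)
            (ψ (1 - S.lam * s))) (sq_nonneg S.lam)
          simp only [boundaryTrace, κ, ℓ]
          linarith
      _ = 2 * S.lam ^ 2 * κ * (∫ s in (0 : ℝ)..t, ‖ψ (0 - S.lam * s)‖ ^ 2) +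
            2 * S.lam ^ 2 * ℓ * ∫ s in (0 : ℝ)..t, ‖ψ (1 - S.lam * s)‖ ^ 2 := by
          rw [intervalIntegral.integral_add ((hint 0).const_mul _) ((hint 1).const_mul _),
            intervalIntegral.integral_const_mul, intervalIntegral.integral_const_mul]
      _ ≤ 2 * S.lam ^ 2 * κ * (S.lam⁻¹ * F) + 2 * S.lam ^ 2 * ℓ * (S.lam⁻¹ * F) := by
          gcongr
          · exact hval 0 (by simp)
          · exact hval 1 (by simp)
      _ = _ := by field_simp
  have hV : 0 ≤ ∫ s in (0 : ℝ)..t, ‖u s‖ ^ 2 :=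
    intervalIntegral.integral_nonneg ht.1 fun _ _ => by positivity
  set V := ∫ s in (0 : ℝ)..t, ‖u s‖ ^ 2
  rw [hz₀] at hF
  have hF2 : F ≤ M * (1 + S.lam * β) * (‖z₀‖ ^ 2 + V) := by
    refine hF.trans ?_
    rw [mul_assoc]
    refine mul_le_mul_of_nonneg_left ?_ hM
    have hβ : 0 ≤ S.lam * β := by positivity
    nlinarith [sq_nonneg ‖z₀‖, mul_nonneg hβ (sq_nonneg ‖z₀‖)]
  have hC : 0 ≤ 1 + 2 * S.lam * (κ + ℓ) := by positivity
  calc _ ≤ (1 + 2 * S.lam * (κ + ℓ)) * F := by linarith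
    _ ≤ (1 + 2 * S.lam * (κ + ℓ)) * (M * (1 + S.lam * β) * (‖z₀‖ ^ 2 + V)) := by gcongr
    _ = _ := by ring

end PHSystem

/-! ### Lifting along an isometry -/

section lift

variable {k d : ℕ} (J : CVec k →ₗᵢ[ℂ] CVec d)

/-- The map `liftL2 J` as an operator. -/
def liftCLM : L2Unit k →L[ℂ] L2Unit d := J.toContinuousLinearMap.compLpL 2 unitMeasure

lemma coeFn_liftL2 (w : L2Unit k) : liftL2 J w =ᵐ[unitMeasure] fun ζ => J (w ζ) :=
  ContinuousLinearMap.coeFn_compLp _ _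

lemma norm_liftL2 (w : L2Unit k) : ‖liftL2 J w‖ = ‖w‖ := by
  rw [Lp.norm_def, Lp.norm_def]
  congr 1
  refine eLpNorm_congr_norm_ae ?_
  filter_upwards [coeFn_liftL2 J w] with ζ hζ
  rw [hζ, J.norm_map]

lemma isometry_liftCLM : Isometry (liftCLM J) :=
  AddMonoidHomClass.isometry_of_norm _ (norm_liftL2 J)

lemma isClosed_range_liftL2 : IsClosed (range (liftL2 J)) :=
  (isometry_liftCLM J).isClosedEmbedding.isClosed_range

lemma range_liftL2 : range (liftL2 J) = L2Sub (LinearMap.range J.toLinearMap) := by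
  ext z
  constructor
  · rintro ⟨w, rfl⟩
    filter_upwards [coeFn_liftL2 J w] with ζ hζ
    exact ⟨w ζ, hζ.symm⟩
  · intro hz
    -- A linear left inverse of `J`, continuous in finite dimension, recovers square integrable
    -- coordinates from `z`.
    obtain ⟨P, hP⟩ := J.toLinearMap.exists_leftInverse_of_injective
      (LinearMap.ker_eq_bot.2 J.injective)
    refine ⟨P.toContinuousLinearMap.compLp z, Lp.ext ?_⟩
    filter_upwards [coeFn_liftL2 J (P.toContinuousLinearMap.compLp z),
      ContinuousLinearMap.coeFn_compLp P.toContinuousLinearMap z, hz] with ζ h1 h2 h3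
    obtain ⟨v, hv⟩ := h3
    rw [h1, h2, ← hv]
    exact congrArg J (LinearMap.congr_fun hP v)

lemma primitiveCLM_liftL2 {ζ : ℝ} (hζ : ζ ∈ Icc (0 : ℝ) 1) (w : L2Unit k) :
    primitiveCLM ζ (liftL2 J w) = J (primitiveCLM ζ w) := by
  rw [primitiveCLM_eq_of_ae hζ (coeFn_liftL2 J w), primitiveCLM_eq hζ,
    J.intervalIntegral_comp_comm]

lemma IsH1With.lift {w w' : L2Unit k} {a b : CVec k} (h : IsH1With w w' a b) :
    IsH1With (liftL2 J w) (liftL2 J w') (J a) (J b) := by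
  rw [iff_primitive] at *
  refine ⟨?_, by rw [h.2, map_add, primitiveCLM_liftL2 J (by simp)]⟩
  filter_upwards [h.1, coeFn_liftL2 J w, ae_restrict_mem measurableSet_Ioo] with ζ h1 h2 h3
  rw [h2, h1, map_add, primitiveCLM_liftL2 J (Ioo_subset_Icc_self h3)]

end lift

namespace PHSystem

variable {q p m : ℕ} {S : PHSystem q p m}

/-! ### The discrete-time system -/

lemma mem_discreteOutputNulling {v : CVec (q + p)} : v ∈ S.discreteOutputNulling ↔
    ∃ (w : ℕ → CVec (q + p)) (u : ℕ → CVec p), w 0 = v ∧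
      ∀ k, w (k + 1) = mulVecCLM S.Ad (w k) + mulVecCLM S.Bd (u k) ∧
        mulVecCLM S.Cd (w k) + mulVecCLM S.Dd (u k) = 0 := by
  constructor
  · rintro ⟨w, u, h0, h⟩
    refine ⟨fun k => WithLp.toLp 2 (w k), fun k => WithLp.toLp 2 (u k),
      WithLp.ofLp_injective 2 h0, fun k => ⟨WithLp.ofLp_injective 2 ?_,
        WithLp.ofLp_injective 2 ?_⟩⟩
    · simpa using (h k).1
    · simpa using (h k).2
  · rintro ⟨w, u, h0, h⟩
    refine ⟨fun k => (w k).ofLp, fun k => (u k).ofLp, congrArg _ h0, fun k => ⟨?_, ?_⟩⟩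
    · simpa using congrArg WithLp.ofLp (h k).1
    · simpa using congrArg WithLp.ofLp (h k).2

/-- Controlled invariance: the tail of an output nulling trajectory is again one. -/
lemma exists_step_of_mem {v : CVec (q + p)} (hv : v ∈ S.discreteOutputNulling) :
    ∃ u : CVec p, mulVecCLM S.Ad v + mulVecCLM S.Bd u ∈ S.discreteOutputNulling ∧
      mulVecCLM S.Cd v + mulVecCLM S.Dd u = 0 := by
  obtain ⟨w, u, rfl, h⟩ := mem_discreteOutputNulling.1 hv
  refine ⟨u 0, ?_, (h 0).2⟩
  rw [← (h 0).1]
  exact mem_discreteOutputNulling.2 ⟨fun k => w (k + 1), fun k => u (k + 1), rfl,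
    fun k => h (k + 1)⟩

lemma exists_mulVecCLM_eq {a b : ℕ} (T : CVec b →ₗ[ℂ] CVec a) :
    ∃ P : Matrix (Fin a) (Fin b) ℂ, ∀ x, mulVecCLM P x = T x :=
  ⟨(Matrix.toLpLin 2 2).symm T, fun x => by simp [mulVecCLM]⟩

/-- A feedback `F` that keeps the output zero on `V_d*`, in coordinates `J` of `V_d*`; `G` is the
resulting dynamics. -/
theorem exists_feedback (S : PHSystem q p m) :
    ∃ (k : ℕ) (J : CVec k →ₗᵢ[ℂ] CVec (q + p)) (F : Matrix (Fin p) (Fin k) ℂ)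
      (G : Matrix (Fin k) (Fin k) ℂ),
      LinearMap.range J.toLinearMap = S.discreteOutputNulling ∧
      ∀ x, mulVecCLM S.Ad (J x) + mulVecCLM S.Bd (mulVecCLM F x) = J (mulVecCLM G x) ∧
        mulVecCLM S.Cd (J x) + mulVecCLM S.Dd (mulVecCLM F x) = 0 := by
  let V := S.discreteOutputNulling
  let e := (stdOrthonormalBasis ℂ V).repr
  let J : CVec (Module.finrank ℂ V) →ₗᵢ[ℂ] CVec (q + p) :=
    V.subtypeₗᵢ.comp e.symm.toLinearIsometry
  have hJ : LinearMap.range J.toLinearMap = V := by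
    ext v
    constructor
    · rintro ⟨x, rfl⟩
      exact (e.symm x).2
    · intro hv
      exact ⟨e ⟨v, hv⟩, by simp [J]⟩
  have hmem : ∀ x, J x ∈ V := fun x => (e.symm x).2
  let B := (EuclideanSpace.basisFun (Fin (Module.finrank ℂ V)) ℂ).toBasis
  -- Zeroing inputs need not be unique, but choosing one per basis vector and extending linearly
  -- gives a feedback, because both required identities are linear.
  have hstep : ∀ i, ∃ ux : CVec p × CVec (Module.finrank ℂ V),
      mulVecCLM S.Ad (J (B i)) + mulVecCLM S.Bd ux.1 = J ux.2 ∧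
        mulVecCLM S.Cd (J (B i)) + mulVecCLM S.Dd ux.1 = 0 := fun i => by
    obtain ⟨u, h1, h2⟩ := exists_step_of_mem (hmem (B i))
    have h3 : mulVecCLM S.Ad (J (B i)) + mulVecCLM S.Bd u ∈ LinearMap.range J.toLinearMap := by
      rw [hJ]; exact h1
    obtain ⟨x, hx⟩ := h3
    exact ⟨(u, x), hx.symm, h2⟩
  choose ux hux1 hux2 using hstep
  obtain ⟨F, hF⟩ := exists_mulVecCLM_eq (B.constr ℂ fun i => (ux i).1)
  obtain ⟨G, hG⟩ := exists_mulVecCLM_eq (B.constr ℂ fun i => (ux i).2)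
  refine ⟨_, J, F, G, hJ, fun x => ⟨?_, ?_⟩⟩
  · have : (mulVecCLM S.Ad).toLinearMap ∘ₗ J.toLinearMap +
        (mulVecCLM S.Bd).toLinearMap ∘ₗ (mulVecCLM F).toLinearMap =
        J.toLinearMap ∘ₗ (mulVecCLM G).toLinearMap :=
      B.ext fun i => by simpa [hF, hG] using hux1 i
    exact LinearMap.congr_fun this x
  · have : (mulVecCLM S.Cd).toLinearMap ∘ₗ J.toLinearMap +
        (mulVecCLM S.Dd).toLinearMap ∘ₗ (mulVecCLM F).toLinearMap = 0 :=
      B.ext fun i => by simpa [hF] using hux2 i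
    exact LinearMap.congr_fun this x

/-! ### The restriction to the largest output nulling subspace -/

/-- The restriction of the dynamics to `L²(0,1;V_d*)` in coordinates, for the feedback `F` with
closed-loop matrix `G`. -/
def restricted {k : ℕ} (S : PHSystem q p m) (F : Matrix (Fin p) (Fin k) ℂ)
    (G : Matrix (Fin k) (Fin k) ℂ) : PHSystem k 0 p where
  lam := S.lam
  K := 1
  L := -G
  Ky := 0
  Ly := (-(S.lam : ℂ)⁻¹) • F

lemma embLast_zero_right (k : ℕ) (v : CVec 0) : embLast k 0 v = 0 := by
  rw [Subsingleton.elim v 0, map_zero]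

lemma intervalIntegral_compLp_lift {k d : ℕ} (J : CVec k →ₗᵢ[ℂ] CVec d) {w : ℝ → L2Unit k}
    (hw : ContinuousOn w (Ici 0)) {t : ℝ} (ht : 0 ≤ t) :
    ∫ s in (0 : ℝ)..t, liftL2 J (w s) = liftL2 J (∫ s in (0 : ℝ)..t, w s) :=
  (liftCLM J).intervalIntegral_comp_comm (intervalIntegrable_of_continuousOn_Ici hw ht)

/-- For the time integral of `w`, the restricted boundary conditions say `a = G b` and `∫ u = F b`.
Inserted into the two feedback identities at `b`, they become the boundary and output equations of
the original system for `J a`, `J b`. -/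
theorem IsMildSolution.lift (hlam : 0 < S.lam) (hK : IsUnit S.K.det) {k : ℕ}
    {J : CVec (k + 0) →ₗᵢ[ℂ] CVec (q + p)} {F : Matrix (Fin p) (Fin k) ℂ}
    {G : Matrix (Fin k) (Fin k) ℂ}
    (hJ : ∀ x, mulVecCLM S.Ad (J x) + mulVecCLM S.Bd (mulVecCLM F x) = J (mulVecCLM G x) ∧
        mulVecCLM S.Cd (J x) + mulVecCLM S.Dd (mulVecCLM F x) = 0)
    {w₀ : L2Unit (k + 0)} {v : ℝ → CVec 0} {w : ℝ → L2Unit (k + 0)} {u : ℝ → CVec p}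
    (h : (S.restricted F G).IsMildSolution w₀ v w u) :
    S.IsMildSolution (liftL2 J w₀) u (fun t => liftL2 J (w t)) 0 := by
  have hl : (S.lam : ℂ) ≠ 0 := by exact_mod_cast hlam.ne'
  rw [isMildSolution_iff] at *
  obtain ⟨-, hu, hw, hw0, hmild⟩ := h
  refine ⟨hu, IsL2Loc.zero, (liftCLM J).continuous.comp_continuousOn hw, by rw [hw0],
    fun t ht => ?_⟩
  obtain ⟨w', a, b, h1, h2, h3, h4⟩ := hmild t ht
  have ha : a = mulVecCLM G b := by
    simp only [restricted, embLast_zero_right] at h3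
    have h5 : (-(S.lam : ℂ)) • (mulVecCLM (1 : Matrix (Fin (k + 0)) (Fin (k + 0)) ℂ) a +
        mulVecCLM (-G) b) = 0 := by
      rw [h3, smul_add, neg_smul, neg_smul]; abel
    have h6 := (smul_eq_zero.1 h5).resolve_left (neg_ne_zero.2 hl)
    rw [mulVecCLM_one, mulVecCLM_neg] at h6
    exact sub_eq_zero.1 (by rw [sub_eq_add_neg]; exact h6)
  have hub : ∫ s in (0 : ℝ)..t, u s = mulVecCLM F b := by
    rw [h4]
    simp only [restricted, mulVecCLM_zero, smul_zero, zero_sub]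
    rw [mulVecCLM_smul, smul_smul, ← neg_smul, mul_neg, neg_neg, mul_inv_cancel₀ hl, one_smul]
  have hJa : J a = mulVecCLM S.Ad (J b) + mulVecCLM S.Bd (mulVecCLM F b) := by
    rw [ha]; exact (hJ b).1.symm
  refine ⟨liftL2 J w', J a, J b, ?_, ?_, ?_, ?_⟩
  · rw [intervalIntegral_compLp_lift J hw ht]
    exact h1.lift J
  · have := congrArg (liftCLM J) h2
    rw [map_sub, map_smul] at this
    exact this
  · rw [hub, hJa, map_add, mulVecCLM_K_Ad hK, mulVecCLM_K_Bd hK, smul_add, smul_smul, neg_mul_neg,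
      mul_inv_cancel₀ hl, one_smul, smul_neg, neg_smul, neg_neg]
    abel
  · have h5 := (hJ b).2
    rw [mulVecCLM_Cd, mulVecCLM_Dd] at h5
    simp only [Pi.zero_apply, intervalIntegral.integral_zero]
    rw [hJa, map_add, smul_add, ← h5]
    abel

theorem isWellPosed_restricted (hlam : 0 < S.lam) {k : ℕ} (F : Matrix (Fin p) (Fin k) ℂ)
    (G : Matrix (Fin k) (Fin k) ℂ) : (S.restricted F G).IsWellPosed :=
  isWellPosed_of_isUnit_det hlam (by
    change IsUnit (1 : Matrix (Fin (k + 0)) (Fin (k + 0)) ℂ).det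
    simp)

/-- By uniqueness the solution is the travelling wave. For almost every `x` its samples `ψ(x - k)`,
with the inputs at times `(k+1-x)/λ₀`, are a discrete trajectory starting at `z₀(x)` with vanishing
output. -/
theorem outputNulling_subset (hlam : 0 < S.lam) (hK : IsUnit S.K.det) :
    S.outputNulling ⊆ L2Sub S.discreteOutputNulling := by
  rintro z₀ ⟨u, z, h⟩
  obtain ⟨ψ, hψ, hψ0, hrec, hmild⟩ := exists_travelWave_solution hlam hK z₀ h.1
  have hy := (hmild.unique hlam hK h (ae_eq_refl _)).2
  have hi : -S.lam⁻¹ ≠ 0 := neg_ne_zero.2 (inv_pos.2 hlam).ne'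
  -- The output vanishes only for almost every time. Countably many affine changes of variable give
  -- one null set of `x` outside of which all sampled outputs vanish.
  have h1 : ∀ᵐ x : ℝ, ∀ k : ℕ, 0 < S.lam⁻¹ * (k + 1) + (-S.lam⁻¹) * x →
      boundaryTrace S.lam S.Ky S.Ly ψ (S.lam⁻¹ * (k + 1) + (-S.lam⁻¹) * x) = 0 :=
    ae_all_iff.2 fun k => ae_comp_affine hi _ ((ae_restrict_iff' measurableSet_Ioi).1 hy)
  filter_upwards [ae_restrict_of_ae h1, hψ0, ae_restrict_mem measurableSet_Ioo] with x hx hx0 hmem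
  refine mem_discreteOutputNulling.2 ⟨fun k => ψ (x - k),
    fun k => u (0 + (-S.lam⁻¹) * (x - (k + 1))), by simp [hx0], fun k => ?_⟩
  have hneg : x - (k + 1) < 0 := by
    have : (0 : ℝ) ≤ k := Nat.cast_nonneg k
    linarith [hmem.2]
  have h2 := hrec _ hneg
  rw [show x - ((k : ℝ) + 1) + 1 = x - k by ring] at h2
  refine ⟨by push_cast; exact h2, ?_⟩
  have h3 := hx k (by
    have := mul_pos (inv_pos.2 hlam) (neg_pos.2 hneg)
    linarith)
  have e : S.lam * (S.lam⁻¹ * (k + 1) + (-S.lam⁻¹) * x) = k + 1 - x := by field_simp; ring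
  rw [boundaryTrace, e, show (0 : ℝ) - (k + 1 - x) = x - (k + 1) by ring,
    show (1 : ℝ) - (k + 1 - x) = x - k by ring, h2] at h3
  rw [mulVecCLM_Cd, mulVecCLM_Dd, ← h3, map_add, smul_add]
  abel

/-! ### Uniqueness of the zeroing input -/

theorem ZeroSystemWellPosed.zeroingInputUnique (h : S.ZeroSystemWellPosed) :
    S.ZeroingInputUnique := by
  rintro u ⟨z, hz⟩
  have h0 : S.IsMildSolution 0 0 0 0 := by
    have := hz.sub hz
    simpa using this
  exact (h.2.1 0 u 0 z 0 hz h0).2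

theorem ZeroingInputUnique.unique (hlam : 0 < S.lam) (hK : IsUnit S.K.det)
    (h : S.ZeroingInputUnique) {z₀ : L2Unit (q + p)} {u₁ u₂ : ℝ → CVec p}
    {z₁ z₂ : ℝ → L2Unit (q + p)} (h₁ : S.IsMildSolution z₀ u₁ z₁ 0)
    (h₂ : S.IsMildSolution z₀ u₂ z₂ 0) :
    EqOn z₁ z₂ (Ici 0) ∧ u₁ =ᵐ[volume.restrict (Ioi (0 : ℝ))] u₂ := by
  have hs := h₁.sub h₂
  rw [sub_self, sub_self] at hs
  have hu : u₁ =ᵐ[volume.restrict (Ioi (0 : ℝ))] u₂ := by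
    filter_upwards [h _ ⟨_, hs⟩] with t ht using sub_eq_zero.1 ht
  exact ⟨(h₁.unique hlam hK h₂ hu).1, hu⟩

end PHSystem

end

/-! ### The largest output nulling subspace and the zero dynamics -/

theorem theorem3p4 (q p m : ℕ) (S : PHSystem q p m) (hlam : 0 < S.lam) (hK : IsUnit S.K.det) :
    S.outputNulling = L2Sub S.discreteOutputNulling ∧
    IsClosed S.outputNulling ∧
    (S.ZeroSystemWellPosed ↔ S.ZeroingInputUnique) ∧
    ∃ (k : ℕ) (J : CVec (k + 0) →ₗᵢ[ℂ] CVec (q + p)) (R : PHSystem k 0 p),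
      LinearMap.range J.toLinearMap = S.discreteOutputNulling ∧
      Set.range (liftL2 J) = S.outputNulling ∧
      R.lam = S.lam ∧
      IsUnit R.K.det ∧
      R.IsWellPosed ∧
      (∀ (w₀ : L2Unit (k + 0)) (w : ℝ → L2Unit (k + 0)) (u : ℝ → CVec p),
        R.IsMildSolution w₀ 0 w u →
          S.IsMildSolution (liftL2 J w₀) u (fun t => liftL2 J (w t)) 0) ∧
      (S.ZeroingInputUnique →
        ∀ (z₀ : L2Unit (q + p)) (z : ℝ → L2Unit (q + p)) (u : ℝ → CVec p),
          S.IsMildSolution z₀ u z 0 ↔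
            ∃ (w₀ : L2Unit (k + 0)) (w : ℝ → L2Unit (k + 0)), R.IsMildSolution w₀ 0 w u ∧
              z₀ = liftL2 J w₀ ∧ ∀ t : ℝ, 0 ≤ t → z t = liftL2 J (w t)) := by
  obtain ⟨k, J, F, G, hJr, hJ⟩ := PHSystem.exists_feedback S
  have hwp : (S.restricted F G).IsWellPosed := PHSystem.isWellPosed_restricted hlam F G
  have hlift : ∀ (w₀ : L2Unit (k + 0)) (w : ℝ → L2Unit (k + 0)) (u : ℝ → CVec p),
      (S.restricted F G).IsMildSolution w₀ 0 w u →
        S.IsMildSolution (liftL2 J w₀) u (fun t => liftL2 J (w t)) 0 :=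
    fun w₀ w u h => h.lift hlam hK hJ
  have hrange : range (liftL2 J) = S.outputNulling := by
    refine Subset.antisymm ?_ ?_
    · rintro _ ⟨w₀, rfl⟩
      obtain ⟨w, u, h⟩ := hwp.1 w₀ 0 IsL2Loc.zero
      exact ⟨u, _, hlift w₀ w u h⟩
    · rw [range_liftL2, hJr]
      exact PHSystem.outputNulling_subset hlam hK
  have hrep : S.ZeroingInputUnique → ∀ (z₀ : L2Unit (q + p)) (z : ℝ → L2Unit (q + p))
      (u : ℝ → CVec p), S.IsMildSolution z₀ u z 0 →
        ∃ (w₀ : L2Unit (k + 0)) (w : ℝ → L2Unit (k + 0)),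
          (S.restricted F G).IsMildSolution w₀ 0 w u ∧
            z₀ = liftL2 J w₀ ∧ ∀ t : ℝ, 0 ≤ t → z t = liftL2 J (w t) := by
    intro huniq z₀ z u h
    have hz₀ : z₀ ∈ range (liftL2 J) := hrange ▸ ⟨u, z, h⟩
    obtain ⟨w₀, rfl⟩ := hz₀
    -- The lift of this solution also has zero output and starts at the same state, so uniqueness
    -- identifies it with `z`, and `u'` with `u` up to a null set.
    obtain ⟨w, u', hw⟩ := hwp.1 w₀ 0 IsL2Loc.zero
    obtain ⟨h1, h2⟩ := huniq.unique hlam hK h (hlift w₀ w u' hw)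
    exact ⟨w₀, w, hw.congr (ae_eq_refl _) (eqOn_refl _ _) h2.symm, rfl, fun t ht => h1 ht⟩
  refine ⟨by rw [← hrange, range_liftL2, hJr], hrange ▸ isClosed_range_liftL2 J,
    ⟨PHSystem.ZeroSystemWellPosed.zeroingInputUnique, fun huniq => ⟨?_, ?_, fun T hT => ?_⟩⟩,
    k, J, S.restricted F G, hJr, hrange, rfl, ?_, hwp, hlift, fun huniq z₀ z u =>
      ⟨hrep huniq z₀ z u, ?_⟩⟩
  · rw [← hrange]
    rintro _ ⟨w₀, rfl⟩
    obtain ⟨w, u, h⟩ := hwp.1 w₀ 0 IsL2Loc.zero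
    exact ⟨u, _, hlift w₀ w u h, fun t _ => mem_range_self (w t)⟩
  · exact fun z₀ u₁ u₂ z₁ z₂ h₁ h₂ => huniq.unique hlam hK h₁ h₂
  -- Every solution with zero output is a lift and `J` preserves norms, so the constant of the
  -- restricted system serves; its input term vanishes.
  · obtain ⟨M, hM⟩ := hwp.2.2 T hT
    refine ⟨M, fun z₀ u z h t ht => ?_⟩
    obtain ⟨w₀, w, hw, rfl, hz⟩ := hrep huniq z₀ z u h
    rw [hz t ht.1, norm_liftL2, norm_liftL2]
    simpa using hM w₀ 0 w u hw t ht
  · change IsUnit (1 : Matrix (Fin (k + 0)) (Fin (k + 0)) ℂ).det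
    simp
  · rintro ⟨w₀, w, hw, rfl, hz⟩
    exact (hlift w₀ w u hw).congr (ae_eq_refl _) (fun t ht => (hz t ht).symm) (ae_eq_refl _)
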